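/- A cut of a finite graph $G=(V,E)$ with edge weights $X\in\mathbb{R}^E$ is a map $\sigma\colon V\to\{-1,1\}$; its value is $v(\sigma)=\frac12\sum_{uv\in E}(1-\sigma(u)\sigma(v))X_{uv}$. An execution of the 3-FLIP algorithm from $\sigma$ is a finite sequence of moves, each of which switches the side of at most three vertices and strictly increases the value of the current cut, and which ends in a cut whose value cannot be increased by switching at most three vertices; its number of steps is the number of moves. For $k,m\ge 0$ let $H_{k,m}$ be the disjoint union of $2k$ copies of the depth-two tree obtained from the star $K_{1,2m}$ by attaching two new vertices to each of its $2m$ leaves. **Theorem 1.** There are constants $C,c>0$ and a function $k\mapsto m_k$ such that, with $k=\lfloor\sqrt n\rfloor$, the graph $G_n:=H_{k,m_k}$ has at most $Cn$ vertices for every $n\in\mathbb{N}$, and the following holds for all real numbers $a<b$. Let the edge weights of $G_n$ be independent and uniformly distributed on $[a,b]$, and let the initial cut be uniformly random among all cuts of $G_n$, independent of the weights. Then, with probability tending to $1$ as $n\to\infty$, there is an execution of the 3-FLIP algorithm from the initial cut that takes at least $2^{c\sqrt n}$ steps. -/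

import Mathlib

open MeasureTheory ProbabilityTheory Filter Topology

/-- A cut of a graph with vertex set `V`: an assignment of a side `1` or `-1` to every vertex.
(`ℤˣ` is the two-element set `{1, -1}`.) -/
abbrev Cut (V : Type*) := V → ℤˣ

section MaxCut

variable {V : Type*}

/-- The value `v(σ) = (1 / 2) * ∑_{uv ∈ E} (1 - σ(u) σ(v)) X_{uv}` of the cut `σ`
in the graph `G` with edge weights `X`. -/
noncomputable def cutValue (G : SimpleGraph V) [Fintype G.edgeSet]
    (X : G.edgeSet → ℝ) (σ : Cut V) : ℝ :=
  (1 / 2) * ∑ e : G.edgeSet, (1 - (((e.1.map σ).mul : ℤˣ) : ℤ) : ℝ) * X e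

/-- The cut obtained from `σ` by moving all vertices of `S` across the cut. -/
def flipSet [DecidableEq V] (σ : Cut V) (S : Finset V) : Cut V :=
  fun v => if v ∈ S then -σ v else σ v

/-- The cut obtained from `σ` by performing all the moves of `L`, in order. -/
def flipSeq [DecidableEq V] (σ : Cut V) (L : List (Finset V)) : Cut V :=
  L.foldl flipSet σ

/-- `L` is a `k`-flip sequence that is improving from `σ`: each move consists of at most `k`
vertices and strictly increases the value of the current cut. -/
def IsImprovingFlipSeq [DecidableEq V] (G : SimpleGraph V) [Fintype G.edgeSet]
    (X : G.edgeSet → ℝ) (k : ℕ) : Cut V → List (Finset V) → Prop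
  | _, [] => True
  | σ, S :: L => S.card ≤ k ∧ cutValue G X σ < cutValue G X (flipSet σ S) ∧
      IsImprovingFlipSeq G X k (flipSet σ S) L

/-- `σ` is a local optimum for `k`-FLIP: moving at most `k` vertices never increases its value. -/
def IsFlipLocalOpt [DecidableEq V] (G : SimpleGraph V) [Fintype G.edgeSet]
    (X : G.edgeSet → ℝ) (k : ℕ) (σ : Cut V) : Prop :=
  ∀ S : Finset V, S.card ≤ k → cutValue G X (flipSet σ S) ≤ cutValue G X σ

/-- `L` is the list of moves of an execution of the `k`-FLIP algorithm from the initial cut `σ`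
(for some choice of the improving move in every step): an improving `k`-flip sequence that ends
in a local optimum. The number of steps of the execution is `L.length`. -/
def IsFlipExecution [DecidableEq V] (G : SimpleGraph V) [Fintype G.edgeSet]
    (X : G.edgeSet → ℝ) (k : ℕ) (σ : Cut V) (L : List (Finset V)) : Prop :=
  IsImprovingFlipSeq G X k σ L ∧ IsFlipLocalOpt G X k (flipSeq σ L)

/-- The joint law of independent edge weights, each uniform on `[a, b]`, and of an independent
uniformly random cut. -/
noncomputable def randomInstance [Fintype V] (G : SimpleGraph V) [Fintype G.edgeSet]
    (a b : ℝ) : Measure ((G.edgeSet → ℝ) × Cut V) :=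
  (Measure.pi fun _ : G.edgeSet => (volume : Measure ℝ)[|Set.Icc a b]).prod
    (uniformOn (Set.univ : Set (Cut V)))

end MaxCut

/-- The vertices of the depth-two tree with `2 m` middle vertices and two leaves below each. -/
inductive TreeVertex (m : ℕ)
  | center : TreeVertex m
  | mid (s : Fin (2 * m)) : TreeVertex m
  | leaf (s : Fin (2 * m)) (j : Fin 2) : TreeVertex m
  deriving DecidableEq, Fintype

/-- The tree obtained from the star `K_{1, 2m}` by attaching two new vertices to each of its
leaves. -/
def depthTwoTree (m : ℕ) : SimpleGraph (TreeVertex m) :=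
  SimpleGraph.fromRel fun x y =>
    match x, y with
    | .center, .mid _ => True
    | .mid s, .leaf t _ => s = t
    | _, _ => False

/-- The vertices of the forest `depthTwoForest k m`: a tree index, which is one of `2 k` values,
and a vertex of that tree. -/
abbrev ForestVertex (k m : ℕ) := (Fin k × Fin 2) × TreeVertex m

/-- The disjoint union of `2 k` copies of `depthTwoTree m`. -/
def depthTwoForest (k m : ℕ) : SimpleGraph (ForestVertex k m) where
  Adj x y := x.1 = y.1 ∧ (depthTwoTree m).Adj x.2 y.2
  symm := ⟨fun _ _ h => ⟨h.1.symm, h.2.symm⟩⟩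
  loopless := ⟨fun _ h => h.2.ne rfl⟩

noncomputable instance (k m : ℕ) : DecidableRel (depthTwoForest k m).Adj :=
  Classical.decRel _

/-!
Flipping the center of a tree changes the cut value by the *gain* of that center, a signed sum of
the weights of the edges to the middle vertices. The centers are pairwise non-adjacent, so a set of
centers changes the cut value by the sum of their gains, and flipping a center negates its gain.
If there are pairs of centers whose gains are positive and such that two gains of one pair add up
to less than each gain of the next pair, these centers form a binary counter: flipping back two
centers of one pair together with flipping a center of the next pair is an improving 3-flip, a
carry. Filling the `M`-th digit takes at least `2 ^ M` moves (`fillMoves`,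
`exists_long_execution`).

It remains to produce `M` proportional to `k` levels of exponentially growing gains. A middle
vertex is *free* if the edges to its two leaves outweigh the edge to the center in such a way that
flipping it is an improvement whatever the side of the center; this has a probability of at least
`1 / 64`, and whether it happens is decided by the leaf edges, independently of the weight and of
the side of the edge to the center (`freeFlag`, `measurePreserving_forestData`). Hence before the
counter is started each free middle vertex may be put on the side that is wanted, and a tree can
realize every gain that is *reachable* (`IsReachable`). The key fact is that every interval
`(t, 2 t]` with `ρ ^ N (b - a) ≤ t ≤ (b - a) / 8`, where `ρ < 1` is a constant, contains a
reachable gain with a probability that is bounded below, if the tree has `2 (4 N + 8)` middle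
vertices and `N` is large (`eventually_hitProb_le`).

For this the middle vertices are divided into two families of `N` quadruples and sixteen more.
A free quadruple contributes any signed sum of the two distances `|w₀ - w₁|` and `|w₂ - w₃|`.
The quadruples that are not free contribute a fixed sum of order `√N`, which the first family
brings down to a bounded size by steps towards `0` (`eventually_abs_steered_le`). In the second
family each quadruple makes a step towards `0` by the larger distance and a step by the smaller distance in
a direction that is free to choose, so that there are `2 ^ N` end points, all of bounded size; for
two random choices of the directions the end points are within distance `t` of each other only with
probability `O(t / (b - a))` (`sum_collision_le`). The sixteen last weights shift each end point
into `(t, 2 t]` with probability of order `t / (b - a)` (`le_finalLaw_total`), and the second moment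
method (`sq_sum_measure_le`) shows that some choice of directions succeeds with constant
probability.

Finally the trees are independent, so a Chernoff bound (`measure_card_lt_le`) and a union bound over
the levels give at least `2 (M + 1)` suitable trees for every level, from which two trees per level
can be picked without repetition by Hall's theorem.
-/

/-! ### Edges of the forest and cut values -/

/-- Indices of the vertices of `depthTwoForest k m` other than the centers: a tree, a middle vertex
`s` of that tree, and either `none` (the middle vertex `s` itself) or `some j` (its `j`-th leaf). -/
abbrev ChildIndex (k m : ℕ) := ((Fin k × Fin 2) × Fin (2 * m)) × Option (Fin 2)

variable {k m : ℕ}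

/-- The vertex with index `c`. -/
def child (c : ChildIndex k m) : ForestVertex k m :=
  (c.1.1, match c.2 with
    | none => .mid c.1.2
    | some j => .leaf c.1.2 j)

/-- The neighbour of `child c` on the path to the center of its tree. -/
def parent (c : ChildIndex k m) : ForestVertex k m :=
  (c.1.1, match c.2 with
    | none => .center
    | some _ => .mid c.1.2)

/-- The center of the tree `τ`. -/
def center (τ : Fin k × Fin 2) : ForestVertex k m := (τ, .center)

lemma adj_child_parent (c : ChildIndex k m) :
    (depthTwoForest k m).Adj (child c) (parent c) := by
  obtain ⟨⟨τ, s⟩, _ | j⟩ := c <;>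
    simp [depthTwoForest, child, parent, depthTwoTree, SimpleGraph.fromRel_adj]

/-- The edges of the forest are indexed by their endpoints that are farther from the center. -/
noncomputable def edgeEquiv (k m : ℕ) : ChildIndex k m ≃ (depthTwoForest k m).edgeSet :=
  Equiv.ofBijective (fun c => ⟨s(child c, parent c), adj_child_parent c⟩) <| by
    constructor
    · rintro ⟨⟨τ, s⟩, _ | j⟩ ⟨⟨τ', s'⟩, _ | j'⟩ h <;>
        simp_all [child, parent]
    · rintro ⟨e, he⟩
      induction e with
      | h x y =>
        obtain ⟨τ, x⟩ := x
        obtain ⟨τ', y⟩ := y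
        obtain ⟨hτ, h⟩ : τ = τ' ∧ (depthTwoTree m).Adj x y := he
        subst hτ
        rw [depthTwoTree, SimpleGraph.fromRel_adj] at h
        rcases x with _ | s | ⟨s, i⟩ <;> rcases y with _ | t | ⟨t, j⟩ <;> simp at h
        · exact ⟨((τ, t), none), by simp [child, parent, Sym2.eq_swap]⟩
        · exact ⟨((τ, s), none), by simp [child, parent]⟩
        · exact ⟨((τ, s), some j), by simp [child, parent, h]⟩
        · exact ⟨((τ, s), some i), by simp [child, parent, h]⟩

/-- The product of the sides of the two ends of an edge: `1` if the edge is not cut, `-1` if it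
is. -/
def relSide (σ : Cut (ForestVertex k m)) (c : ChildIndex k m) : ℤˣ :=
  σ (child c) * σ (parent c)

lemma child_ne_center (c : ChildIndex k m) (τ : Fin k × Fin 2) : child c ≠ center τ := by
  obtain ⟨⟨τ', s⟩, _ | j⟩ := c <;> simp [child, center]

lemma center_injective : Function.Injective (center : Fin k × Fin 2 → ForestVertex k m) :=
  fun _ _ h => (Prod.mk.inj h).1

lemma child_notMem_centers (c : ChildIndex k m) (S : Finset (Fin k × Fin 2)) :
    child c ∉ S.image center := by
  simp only [Finset.mem_image, not_exists, not_and]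
  exact fun τ _ h => child_ne_center c τ h.symm

lemma parent_mem_centers (c : ChildIndex k m) (S : Finset (Fin k × Fin 2)) :
    parent c ∈ S.image center ↔ c.2 = none ∧ c.1.1 ∈ S := by
  obtain ⟨⟨τ, s⟩, _ | j⟩ := c <;> simp [parent, center]

lemma neg_abs_le_unit_mul (u : ℤˣ) (x : ℝ) : -|x| ≤ ((u : ℤ) : ℝ) * x := by
  rcases Int.units_eq_one_or u with rfl | rfl
  · simpa using neg_abs_le x
  · simpa using le_abs_self x

lemma child_mid_ne (q : (Fin k × Fin 2) × Fin (2 * m)) (c : ChildIndex k m) :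
    child c ∈ ({child (q, none)} : Finset (ForestVertex k m)) ↔ c = (q, none) := by
  obtain ⟨⟨τ', s⟩, _ | j⟩ := c <;> obtain ⟨τ, t⟩ := q <;> simp [child]

lemma parent_mid_mem (q : (Fin k × Fin 2) × Fin (2 * m)) (c : ChildIndex k m) :
    parent c ∈ ({child (q, none)} : Finset (ForestVertex k m)) ↔ c.1 = q ∧ c.2 ≠ none := by
  obtain ⟨⟨τ', s⟩, _ | j⟩ := c <;> obtain ⟨τ, t⟩ := q <;> simp [child, parent]

lemma relSide_flip_mid (σ : Cut (ForestVertex k m)) (q q' : (Fin k × Fin 2) × Fin (2 * m)) :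
    relSide (flipSet σ {child (q, none)}) (q', none) =
      if q' = q then -relSide σ (q', none) else relSide σ (q', none) := by
  simp only [relSide, flipSet, child_mid_ne, parent_mid_mem]
  by_cases h : q' = q <;> simp [h]

section

variable (X : (depthTwoForest k m).edgeSet → ℝ)

/-- The change of the cut value when the center of `τ` is flipped. -/
noncomputable def centerGain (σ : Cut (ForestVertex k m)) (τ : Fin k × Fin 2) : ℝ :=
  ∑ s, ((relSide σ ((τ, s), none) : ℤ) : ℝ) * X (edgeEquiv k m ((τ, s), none))

lemma centerGain_flip_centers (σ : Cut (ForestVertex k m)) (S : Finset (Fin k × Fin 2))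
    (τ : Fin k × Fin 2) :
    centerGain X (flipSet σ (S.image center)) τ =
      if τ ∈ S then -centerGain X σ τ else centerGain X σ τ := by
  simp only [centerGain, relSide, flipSet, child_notMem_centers, parent_mem_centers, true_and,
    if_false]
  split_ifs <;> simp

/-- A middle vertex is free if the edges to its two leaves are not cut when their weights are
positive, cut when they are negative, and together outweigh the edge to the center. -/
def IsFreeMid (σ : Cut (ForestVertex k m)) (q : (Fin k × Fin 2) × Fin (2 * m)) : Prop :=
  |X (edgeEquiv k m (q, none))| < ∑ j : Fin 2, ((relSide σ (q, some j) : ℤ) : ℝ) *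
    X (edgeEquiv k m (q, some j))

lemma isFreeMid_flip_mid (σ : Cut (ForestVertex k m)) {q q' : (Fin k × Fin 2) × Fin (2 * m)}
    (h : q' ≠ q) : IsFreeMid X (flipSet σ {child (q, none)}) q' ↔ IsFreeMid X σ q' := by
  simp only [IsFreeMid, relSide, flipSet, child_mid_ne, parent_mid_mem]
  simp [h]

variable [Fintype (depthTwoForest k m).edgeSet]

lemma cutValue_eq (σ : Cut (ForestVertex k m)) :
    cutValue (depthTwoForest k m) X σ =
      (1 / 2) * ∑ c, (1 - ((relSide σ c : ℤ) : ℝ)) * X (edgeEquiv k m c) := by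
  rw [cutValue]
  congr 1
  exact (Equiv.sum_comp (edgeEquiv k m) _).symm

/-- A flip changes the contributions of the edges with exactly one end in `S`. -/
lemma cutValue_flipSet (σ : Cut (ForestVertex k m)) (S : Finset (ForestVertex k m)) :
    cutValue (depthTwoForest k m) X (flipSet σ S) = cutValue (depthTwoForest k m) X σ +
      ∑ c, if (child c ∈ S ↔ parent c ∈ S) then 0
        else ((relSide σ c : ℤ) : ℝ) * X (edgeEquiv k m c) := by
  rw [cutValue_eq, cutValue_eq, Finset.mul_sum, Finset.mul_sum, ← Finset.sum_add_distrib]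
  refine Finset.sum_congr rfl fun c _ => ?_
  by_cases h1 : child c ∈ S <;> by_cases h2 : parent c ∈ S <;>
    simp [relSide, flipSet, h1, h2] <;> ring

/-- Since the centers are pairwise non-adjacent, their gains add up. -/
lemma cutValue_flip_centers (σ : Cut (ForestVertex k m)) (S : Finset (Fin k × Fin 2)) :
    cutValue (depthTwoForest k m) X (flipSet σ (S.image center)) =
      cutValue (depthTwoForest k m) X σ + ∑ τ ∈ S, centerGain X σ τ := by
  rw [cutValue_flipSet]
  congr 1
  rw [Fintype.sum_prod_type, Fintype.sum_prod_type]
  simp only [child_notMem_centers, parent_mem_centers, false_iff, Fintype.sum_option, centerGain,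
    true_and, reduceCtorEq, false_and, ite_not, Finset.sum_ite_irrel, Finset.sum_const_zero]
  simp [Finset.sum_ite_irrel]

lemma cutValue_flip_mid {σ : Cut (ForestVertex k m)} {q : (Fin k × Fin 2) × Fin (2 * m)}
    (h : IsFreeMid X σ q) :
    cutValue (depthTwoForest k m) X σ <
      cutValue (depthTwoForest k m) X (flipSet σ {child (q, none)}) := by
  rw [cutValue_flipSet, lt_add_iff_pos_right, Fintype.sum_prod_type,
    Finset.sum_eq_single q]
  · have := neg_abs_le_unit_mul (relSide σ (q, none)) (X (edgeEquiv k m (q, none)))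
    rw [IsFreeMid] at h
    rw [Fintype.sum_option]
    simp only [child_mid_ne, parent_mid_mem]
    simp
    simp at h
    linarith
  · intro q' _ hq
    simp only [child_mid_ne, parent_mid_mem, Prod.mk.injEq, hq, false_and, iff_self, if_true,
      Finset.sum_const_zero]
  · simp

/-! ### Improving sequences -/

lemma isImprovingFlipSeq_append {V : Type*} [DecidableEq V] {G : SimpleGraph V}
    [Fintype G.edgeSet] {Y : G.edgeSet → ℝ} {r : ℕ} {L₁ L₂ : List (Finset V)} {σ : Cut V} :
    IsImprovingFlipSeq G Y r σ (L₁ ++ L₂) ↔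
      IsImprovingFlipSeq G Y r σ L₁ ∧ IsImprovingFlipSeq G Y r (flipSeq σ L₁) L₂ := by
  induction L₁ generalizing σ with
  | nil => simp [IsImprovingFlipSeq, flipSeq]
  | cons S L ih => simp [IsImprovingFlipSeq, flipSeq, ih, and_assoc]

lemma flipSeq_append {V : Type*} [DecidableEq V] (σ : Cut V) (L₁ L₂ : List (Finset V)) :
    flipSeq σ (L₁ ++ L₂) = flipSeq (flipSeq σ L₁) L₂ := by
  simp [flipSeq]

/-- From every cut there is an execution, since the value increases and there are finitely many
cuts. -/
lemma exists_isFlipExecution {V : Type*} [DecidableEq V] [Finite V] (G : SimpleGraph V)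
    [Fintype G.edgeSet] (Y : G.edgeSet → ℝ) (r : ℕ) (σ : Cut V) :
    ∃ L, IsFlipExecution G Y r σ L := by
  have wf : WellFounded (fun σ₁ σ₂ : Cut V => cutValue G Y σ₂ < cutValue G Y σ₁) :=
    @Finite.wellFounded_of_trans_of_irrefl _ _ _ ⟨fun _ _ _ h₁ h₂ => h₂.trans h₁⟩
      ⟨fun _ => lt_irrefl _⟩
  induction σ using wf.induction with
  | _ σ ih =>
    by_cases h : IsFlipLocalOpt G Y r σ
    · exact ⟨[], trivial, h⟩
    · simp only [IsFlipLocalOpt, not_forall, not_le] at h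
      obtain ⟨S, hS, hlt⟩ := h
      obtain ⟨L, hL⟩ := ih _ hlt
      exact ⟨S :: L, ⟨hS, hlt, hL.1⟩, hL.2⟩

/-- Free middle vertices can be flipped one after the other, in any order. -/
lemma exists_improving_flip_mids (σ : Cut (ForestVertex k m))
    (T : Finset ((Fin k × Fin 2) × Fin (2 * m))) (hT : ∀ q ∈ T, IsFreeMid X σ q) :
    ∃ L, IsImprovingFlipSeq (depthTwoForest k m) X 3 σ L ∧ ∀ q,
      relSide (flipSeq σ L) (q, none) = if q ∈ T then -relSide σ (q, none)
        else relSide σ (q, none) := by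
  induction T using Finset.induction_on generalizing σ with
  | empty => exact ⟨[], trivial, fun q => by simp [flipSeq]⟩
  | insert q T hq ih =>
    obtain ⟨L, hL, hL'⟩ := ih (flipSet σ {child (q, none)}) fun q' hq' =>
      (isFreeMid_flip_mid X σ (ne_of_mem_of_not_mem hq' hq)).2
        (hT q' (Finset.mem_insert_of_mem hq'))
    refine ⟨{child (q, none)} :: L, ⟨by simp, ?_, hL⟩, fun q' => ?_⟩
    · exact cutValue_flip_mid X (hT q (Finset.mem_insert_self _ _))
    · change relSide (flipSeq (flipSet σ {child (q, none)}) L) (q', none) = _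
      rw [hL', relSide_flip_mid]
      by_cases h : q' = q
      · simp [h, hq]
      · simp [h]

lemma flipSet_flipSet_flipSet {V : Type*} [DecidableEq V] (σ : Cut V) {x y z : V} (hxy : x ≠ y)
    (hxz : x ≠ z) (hyz : y ≠ z) :
    flipSet (flipSet (flipSet σ {x}) {y}) {x, y, z} = flipSet σ {z} := by
  ext v
  rcases eq_or_ne v x with rfl | hx
  · simp [flipSet, hxy, hxz]
  rcases eq_or_ne v y with rfl | hy
  · simp [flipSet, hx, hyz]
  simp [flipSet, hx, hy]

/-- The moves of a binary counter with two cells `u i 0` and `u i 1` for the digit `i`: the cell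
`u (i + 1) j` is filled by filling both cells of the digit `i`, followed by a carry, which flips
three centers. -/
def fillMoves (u : ℕ → Fin 2 → Fin k × Fin 2) : ℕ → Fin 2 → List (Finset (Fin k × Fin 2))
  | 0, j => [{u 0 j}]
  | i + 1, j => fillMoves u i 0 ++ fillMoves u i 1 ++ [{u i 0, u i 1, u (i + 1) j}]

lemma two_pow_le_length_fillMoves (u : ℕ → Fin 2 → Fin k × Fin 2) (i : ℕ) (j : Fin 2) :
    2 ^ i ≤ (fillMoves u i j).length := by
  induction i generalizing j with
  | zero => simp [fillMoves]
  | succ i ih =>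
    have h0 := ih 0
    have h1 := ih 1
    simp only [fillMoves, List.length_append, List.length_cons, List.length_nil, pow_succ]
    omega

/-- As long as the cell `u i j` and all cells of lower digits are empty, that is, have their initial
gains, the moves that fill `u i j` are improving. They leave the lower cells empty: the net effect
is that the center `u i j` alone has been flipped. -/
lemma fillMoves_improving {u : ℕ → Fin 2 → Fin k × Fin 2} {M : ℕ}
    (hu : ∀ i ≤ M, ∀ i' ≤ M, ∀ j j', u i j = u i' j' → i = i' ∧ j = j') {g : ℕ → Fin 2 → ℝ}
    (hg0 : ∀ j, 0 < g 0 j) (hg : ∀ i < M, ∀ j, g i 0 + g i 1 < g (i + 1) j)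
    {i : ℕ} (hi : i ≤ M) (j : Fin 2) (σ : Cut (ForestVertex k m))
    (hlow : ∀ i' < i, ∀ j', centerGain X σ (u i' j') = g i' j')
    (htop : centerGain X σ (u i j) = g i j) :
    IsImprovingFlipSeq (depthTwoForest k m) X 3 σ
        ((fillMoves u i j).map (Finset.image center)) ∧
      flipSeq σ ((fillMoves u i j).map (Finset.image center)) =
        flipSet σ (({u i j} : Finset (Fin k × Fin 2)).image center) := by
  induction i generalizing j σ with
  | zero =>
    refine ⟨⟨?_, ?_, trivial⟩, rfl⟩
    · exact Finset.card_image_le.trans (by simp)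
    · rw [cutValue_flip_centers]
      simp [htop, hg0]
  | succ i ih =>
    have hne : u i 0 ≠ u i 1 := fun h => by
      simpa using (hu i (by omega) i (by omega) _ _ h).2
    have hne' : ∀ j', u (i + 1) j ≠ u i j' := fun j' h => by
      simpa using (hu (i + 1) hi i (by omega) _ _ h).1
    have hlt : ∀ i' < i, ∀ j' j'', u i' j' ≠ u i j'' := fun i' hi' j' j'' h => by
      have := (hu i' (by omega) i (by omega) _ _ h).1
      omega
    obtain ⟨h0, h0'⟩ := ih (by omega) 0 σ (fun i' hi' j' => hlow i' (by omega) j')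
      (hlow i (by omega) 0)
    set σ₁ := flipSet σ (({u i 0} : Finset (Fin k × Fin 2)).image center) with hσ₁
    obtain ⟨h1, h1'⟩ := ih (by omega) 1 σ₁
      (fun i' hi' j' => by
        rw [hσ₁, centerGain_flip_centers, if_neg (by simpa using hlt i' hi' j' 0)]
        exact hlow i' (by omega) j')
      (by
        rw [hσ₁, centerGain_flip_centers, if_neg (by simpa using hne.symm)]
        exact hlow i (by omega) 1)
    set σ₂ := flipSet σ₁ (({u i 1} : Finset (Fin k × Fin 2)).image center) with hσ₂
    simp only [fillMoves, List.map_append, List.map_cons, List.map_nil,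
      isImprovingFlipSeq_append, flipSeq_append, h0', h1']
    refine ⟨⟨⟨h0, h1⟩, ?_, ?_, trivial⟩, ?_⟩
    · exact Finset.card_image_le.trans Finset.card_le_three
    · rw [cutValue_flip_centers X σ₂, lt_add_iff_pos_right,
        Finset.sum_insert (by simp [hne, (hne' 0).symm]),
        Finset.sum_insert (by simp [(hne' 1).symm]),
        Finset.sum_singleton, hσ₂, hσ₁]
      simp only [centerGain_flip_centers, Finset.mem_singleton, hne, hne.symm, hne', if_true,
        if_false, htop, hlow i (Nat.lt_succ_self i)]
      linarith [hg i (by omega) j]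
    · simp only [flipSeq, List.foldl_cons, List.foldl_nil, hσ₂, hσ₁, Finset.image_insert,
        Finset.image_singleton]
      exact flipSet_flipSet_flipSet σ (center_injective.ne hne)
        (center_injective.ne (hne' 0).symm) (center_injective.ne (hne' 1).symm)

/-- Suppose that the free middle vertices can be put on sides `ε` for which the centers of
`2 * (M + 1)` different trees have positive gains such that each pair of gains adds up to less than
each gain of the next pair. Then an execution with at least `2 ^ M` steps exists: flip the middle
vertices, run the counter, and continue until a local optimum is reached. -/
lemma exists_long_execution (σ : Cut (ForestVertex k m))
    {ε : (Fin k × Fin 2) × Fin (2 * m) → ℤˣ}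
    (hε : ∀ q, ε q = relSide σ (q, none) ∨ IsFreeMid X σ q)
    {u : ℕ → Fin 2 → Fin k × Fin 2} {M : ℕ}
    (hu : ∀ i ≤ M, ∀ i' ≤ M, ∀ j j', u i j = u i' j' → i = i' ∧ j = j') {g : ℕ → Fin 2 → ℝ}
    (hgε : ∀ i ≤ M, ∀ j, g i j =
      ∑ s, ((ε (u i j, s) : ℤ) : ℝ) * X (edgeEquiv k m ((u i j, s), none)))
    (hg0 : ∀ j, 0 < g 0 j) (hg : ∀ i < M, ∀ j, g i 0 + g i 1 < g (i + 1) j) :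
    ∃ L, IsFlipExecution (depthTwoForest k m) X 3 σ L ∧ 2 ^ M ≤ L.length := by
  obtain ⟨L₁, h₁, h₁'⟩ := exists_improving_flip_mids X σ
    (Finset.univ.filter fun q => ε q ≠ relSide σ (q, none)) fun q hq =>
      (hε q).resolve_left (Finset.mem_filter.1 hq).2
  have hrel : ∀ q, relSide (flipSeq σ L₁) (q, none) = ε q := fun q => by
    rw [h₁' q]
    by_cases h : ε q = relSide σ (q, none)
    · simp [h]
    · have := Int.units_ne_iff_eq_neg.1 h
      simp [this]
  have hgain : ∀ i ≤ M, ∀ j, centerGain X (flipSeq σ L₁) (u i j) = g i j := fun i hi j => by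
    simp only [centerGain, hrel, hgε i hi]
  obtain ⟨h₂, -⟩ := fillMoves_improving X hu hg0 hg le_rfl 0 (flipSeq σ L₁)
    (fun i hi => hgain i hi.le) (hgain M le_rfl 0)
  obtain ⟨L₃, h₃⟩ := exists_isFlipExecution (depthTwoForest k m) X 3
    (flipSeq (flipSeq σ L₁) ((fillMoves u M 0).map (Finset.image center)))
  refine ⟨L₁ ++ (fillMoves u M 0).map (Finset.image center) ++ L₃, ⟨?_, ?_⟩, ?_⟩
  · rw [isImprovingFlipSeq_append, isImprovingFlipSeq_append, flipSeq_append]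
    exact ⟨⟨h₁, h₂⟩, h₃.1⟩
  · rw [flipSeq_append, flipSeq_append]
    exact h₃.2
  · have := two_pow_le_length_fillMoves u M 0
    simp only [List.length_append, List.length_map]
    omega

end

/-! ### The law of the data of the middle vertices -/

instance : DiscreteMeasurableSpace ℤˣ where
  forall_measurableSet s := ⟨Units.val '' s, MeasurableSet.of_discrete,
    Set.preimage_image_eq s Units.val_injective⟩

instance {α : Type*} [Finite α] [Nonempty α] [MeasurableSpace α] [MeasurableSingletonClass α] :
    IsProbabilityMeasure (uniformOn (Set.univ : Set α)) :=
  isProbabilityMeasure_uniformOn Set.finite_univ Set.univ_nonempty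

section MeasurePreserving

variable {ι κ α β : Type*} [Fintype ι] [Fintype κ] [MeasurableSpace α] [MeasurableSpace β]
  (μ : Measure α) [IsProbabilityMeasure μ] (ν : Measure β) [IsProbabilityMeasure ν]

lemma measurePreserving_comp_equiv (e : ι ≃ κ) :
    MeasurePreserving (fun f : κ → α => f ∘ e) (Measure.pi fun _ => μ)
      (Measure.pi fun _ => μ) := by
  convert! measurePreserving_piCongrLeft (α := fun _ : ι => α) (fun _ => μ) e.symm using 1
  funext f i
  simp [MeasurableEquiv.piCongrLeft, Equiv.piCongrLeft]

lemma measurePreserving_curry :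
    MeasurePreserving (fun (f : ι × κ → α) i j => f (i, j)) (Measure.pi fun _ => μ)
      (Measure.pi fun _ => Measure.pi fun _ => μ) := by
  have h := Measure.infinitePi_map_curry (fun (_ : ι) (_ : κ) => μ)
  simp only [Measure.infinitePi_eq_pi] at h
  exact ⟨(MeasurableEquiv.curry ι κ α).measurable, h⟩

lemma measurePreserving_zip :
    MeasurePreserving (fun (p : (ι → α) × (ι → β)) i => (p.1 i, p.2 i))
      ((Measure.pi fun _ => μ).prod (Measure.pi fun _ => ν)) (Measure.pi fun _ => μ.prod ν) :=
  (measurePreserving_arrowProdEquivProdArrow α β ι (fun _ => μ) (fun _ => ν)).symm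

lemma measurePreserving_option :
    MeasurePreserving (fun f : Option ι → α => (f none, fun j => f (some j)))
      (Measure.pi fun _ => μ) (μ.prod (Measure.pi fun _ => μ)) := by
  have h : MeasurePreserving (MeasurableEquiv.piOptionEquivProd (fun _ : Option ι => α)).symm
      ((Measure.pi fun _ => μ).prod μ) (Measure.pi fun _ => μ) :=
    ⟨MeasurableEquiv.measurable _, Measure.pi_map_piOptionEquivProd (fun _ : Option ι => μ)⟩
  exact Measure.measurePreserving_swap.comp h.symm

lemma measurePreserving_prodProdProdComm {γ δ : Type*} [MeasurableSpace γ] [MeasurableSpace δ]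
    (ρ : Measure γ) [IsProbabilityMeasure ρ] (τ : Measure δ) [IsProbabilityMeasure τ] :
    MeasurePreserving (fun p : (α × β) × (γ × δ) => ((p.1.1, p.2.1), (p.1.2, p.2.2)))
      ((μ.prod ν).prod (ρ.prod τ)) ((μ.prod ρ).prod (ν.prod τ)) := by
  -- `(α × β) × (γ × δ) → α × (β × (γ × δ)) → α × ((β × γ) × δ) → α × ((γ × β) × δ) → …`
  have h₁ := measurePreserving_prodAssoc μ ν (ρ.prod τ)
  have h₂ := (MeasurePreserving.id μ).prod (measurePreserving_prodAssoc ν ρ τ).symm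
  have h₃ := (MeasurePreserving.id μ).prod
    ((Measure.measurePreserving_swap (μ := ν) (ν := ρ)).prod (MeasurePreserving.id τ))
  have h₄ := (MeasurePreserving.id μ).prod (measurePreserving_prodAssoc ρ ν τ)
  have h₅ := (measurePreserving_prodAssoc μ ρ (ν.prod τ)).symm
  exact h₅.comp (h₄.comp (h₃.comp (h₂.comp h₁)))

/-- A surjective homomorphism of finite groups maps the uniform distribution to the uniform
distribution, since its fibers have equal size. -/
lemma measurePreserving_uniformOn_of_surjective {G H : Type*} [Group G] [Group H] [Finite G]
    [Finite H] [MeasurableSpace G] [MeasurableSpace H] [MeasurableSingletonClass G]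
    [MeasurableSingletonClass H] (f : G →* H) (hf : Function.Surjective f) :
    MeasurePreserving f (uniformOn (Set.univ : Set G)) (uniformOn (Set.univ : Set H)) := by
  classical
  have := Fintype.ofFinite G
  have := Fintype.ofFinite H
  refine ⟨measurable_of_finite _, ?_⟩
  refine Measure.ext_of_singleton fun y => ?_
  rw [Measure.map_apply (measurable_of_finite _) (measurableSet_singleton y), uniformOn_univ,
    uniformOn_univ]
  have hc : ∀ y' : H, (Finset.univ.filter fun g => f g = y').card =
      (Finset.univ.filter fun g => f g = y).card := fun y' =>
    MonoidHom.card_fiber_eq_of_mem_range f (hf y') (hf y)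
  have hG : Fintype.card G = Fintype.card H * (Finset.univ.filter fun g => f g = y).card := by
    rw [← Finset.card_univ (α := G), Finset.card_eq_sum_card_fiberwise
      (f := f) (t := Finset.univ) (by simp), Finset.sum_congr rfl fun y' _ => hc y']
    simp
  have hpos : (Finset.univ.filter fun g => f g = y).card ≠ 0 := by
    obtain ⟨g, hg⟩ := hf y
    exact (Finset.card_pos.2 ⟨g, by simpa using hg⟩).ne'
  have hpre : f ⁻¹' {y} = ((Finset.univ.filter fun g => f g = y : Finset G) : Set G) := by
    ext; simp
  rw [hpre, Measure.count_apply_finset, Measure.count_singleton, hG]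
  push_cast
  rw [mul_comm, ENNReal.div_eq_inv_mul, ENNReal.mul_inv (by simp) (by simp), mul_comm,
    ← mul_assoc, ENNReal.mul_inv_cancel (by exact_mod_cast hpos) (by simp)]
  simp

end MeasurePreserving

/-- The uniform distribution on `[a, b]`. -/
noncomputable abbrev unif (a b : ℝ) : Measure ℝ := (volume : Measure ℝ)[|Set.Icc a b]

/-- The uniform distribution on `{1, -1}`. -/
noncomputable abbrev coin : Measure ℤˣ := uniformOn Set.univ

lemma isProbabilityMeasure_unif {a b : ℝ} (h : a < b) : IsProbabilityMeasure (unif a b) :=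
  cond_isProbabilityMeasure_of_finite (by simp [h]) (by simp)

/-- What matters about a middle vertex `s`: the weight of the edge from `s` to the center, whether
`s` and the center are on the same side (`1`) or not (`-1`), and whether `s` is free. -/
abbrev MidData := ℝ × ℤˣ × Bool

/-- The law of the data of one middle vertex, when `γ` is the law of the flag that tells whether
the vertex is free. -/
noncomputable abbrev midLaw (a b : ℝ) (γ : Measure Bool) : Measure MidData :=
  (unif a b).prod (coin.prod γ)

/-- The flag that tells that both edges from a middle vertex to a leaf contribute more than `B / 2`
to the change of the cut value when the middle vertex is flipped. -/
noncomputable def freeFlag (B : ℝ) (x : Fin 2 → ℝ) (r : Fin 2 → ℤˣ) : Bool :=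
  decide (∀ j, B / 2 < ((r j : ℤ) : ℝ) * x j)

lemma measurable_freeFlag (B : ℝ) :
    Measurable fun p : (Fin 2 → ℝ) × (Fin 2 → ℤˣ) => freeFlag B p.1 p.2 := by
  refine measurable_to_bool ?_
  have h : (fun p : (Fin 2 → ℝ) × (Fin 2 → ℤˣ) => freeFlag B p.1 p.2) ⁻¹' {true} =
      ⋂ j, {p | B / 2 < ((p.2 j : ℤ) : ℝ) * p.1 j} := by
    ext p; simp [freeFlag]
  rw [h]
  refine MeasurableSet.iInter fun j => measurableSet_lt measurable_const ?_
  refine Measurable.mul ?_ (by fun_prop)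
  exact (measurable_of_finite (fun u : ℤˣ => ((u : ℤ) : ℝ))).comp
    ((measurable_pi_apply j).comp measurable_snd)

/-- The law of `freeFlag`. -/
noncomputable def flagLaw (a b : ℝ) : Measure Bool :=
  ((Measure.pi fun _ : Fin 2 => unif a b).prod (Measure.pi fun _ : Fin 2 => coin)).map
    fun p => freeFlag (max |a| |b|) p.1 p.2

lemma isProbabilityMeasure_flagLaw {a b : ℝ} (h : a < b) :
    IsProbabilityMeasure (flagLaw a b) := by
  have := isProbabilityMeasure_unif h
  exact Measure.isProbabilityMeasure_map (measurable_freeFlag _).aemeasurable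

lemma unif_apply {a b : ℝ} (h : a < b) (s : Set ℝ) :
    unif a b s = ENNReal.ofReal (b - a)⁻¹ * volume (Set.Icc a b ∩ s) := by
  rw [unif, cond_apply measurableSet_Icc, Real.volume_Icc, ENNReal.ofReal_inv_of_pos (by linarith)]

lemma unif_Ioo {a b c d : ℝ} (h : a < b) (hc : a ≤ c) (hd : d ≤ b) :
    unif a b (Set.Ioo c d) = ENNReal.ofReal ((d - c) / (b - a)) := by
  have : Set.Icc a b ∩ Set.Ioo c d = Set.Ioo c d :=
    Set.inter_eq_right.2 fun x hx => ⟨hc.trans hx.1.le, hx.2.le.trans hd⟩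
  rw [unif_apply h, this, Real.volume_Ioo, ← ENNReal.ofReal_mul (by simp [h.le]), div_eq_inv_mul]

/-- For one of the two orientations, a uniform weight has probability at least `1 / 4` to exceed
half of its largest possible absolute value. -/
lemma exists_unit_unif_ge {a b : ℝ} (h : a < b) : ∃ u : ℤˣ,
    ENNReal.ofReal (1 / 4) ≤ unif a b {x | max |a| |b| / 2 < ((u : ℤ) : ℝ) * x} := by
  have hba : 0 < b - a := sub_pos.2 h
  rcases le_total |a| |b| with hab | hab
  · have hb : 0 < b := by
      by_contra hb
      rw [abs_of_nonpos (by linarith), abs_of_nonpos (by linarith)] at hab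
      linarith
    rw [abs_of_pos hb] at hab
    have ha := abs_le.1 hab
    refine ⟨1, ?_⟩
    rw [max_eq_right (by rwa [abs_of_pos hb]), abs_of_pos hb]
    calc ENNReal.ofReal (1 / 4) ≤ ENNReal.ofReal ((b - max a (b / 2)) / (b - a)) := by
          refine ENNReal.ofReal_le_ofReal ?_
          rw [le_div_iff₀ hba]
          rcases max_cases a (b / 2) with h1 | h1 <;> rw [h1.1] <;> linarith
      _ = unif a b (Set.Ioo (max a (b / 2)) b) := (unif_Ioo h (le_max_left _ _) le_rfl).symm
      _ ≤ _ := measure_mono fun x hx => by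
          simpa using (le_max_right _ _).trans_lt hx.1
  · have ha : a < 0 := by
      by_contra ha
      rw [abs_of_nonneg (by linarith), abs_of_nonneg (by linarith)] at hab
      linarith
    rw [abs_of_neg ha] at hab
    have hb := abs_le.1 hab
    refine ⟨-1, ?_⟩
    rw [max_eq_left (by rwa [abs_of_neg ha]), abs_of_neg ha]
    calc ENNReal.ofReal (1 / 4) ≤ ENNReal.ofReal ((min b (a / 2) - a) / (b - a)) := by
          refine ENNReal.ofReal_le_ofReal ?_
          rw [le_div_iff₀ hba]
          rcases min_cases b (a / 2) with h1 | h1 <;> rw [h1.1] <;> linarith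
      _ = unif a b (Set.Ioo a (min b (a / 2))) := (unif_Ioo h le_rfl (min_le_left _ _)).symm
      _ ≤ _ := measure_mono fun x hx => by
          have : x < a / 2 := hx.2.trans_le (min_le_right _ _)
          simp
          linarith

lemma coin_singleton (u : ℤˣ) : coin {u} = ENNReal.ofReal (1 / 2) := by
  rw [coin, uniformOn_univ, Measure.count_singleton]
  simp

/-- Both leaf edges have the orientation of `exists_unit_unif_ge` with probability `1 / 4`, and then
both weights are large with probability at least `1 / 16`. -/
lemma flagLaw_true_ge {a b : ℝ} (h : a < b) : ENNReal.ofReal (1 / 64) ≤ flagLaw a b {true} := by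
  have := isProbabilityMeasure_unif h
  obtain ⟨u, hu⟩ := exists_unit_unif_ge h
  rw [flagLaw, Measure.map_apply (measurable_freeFlag _) (measurableSet_singleton _)]
  calc ENNReal.ofReal (1 / 64)
      = (∏ _j : Fin 2, ENNReal.ofReal (1 / 4)) * ∏ _j : Fin 2, ENNReal.ofReal (1 / 2) := by
        simp only [Finset.prod_const, Finset.card_univ, Fintype.card_fin]
        rw [← ENNReal.ofReal_pow (by norm_num), ← ENNReal.ofReal_pow (by norm_num),
          ← ENNReal.ofReal_mul (by norm_num)]
        norm_num
    _ ≤ (∏ _j : Fin 2, unif a b {x | max |a| |b| / 2 < ((u : ℤ) : ℝ) * x}) *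
          ∏ _j : Fin 2, coin {u} := by
        simp only [coin_singleton]
        gcongr
    _ = ((Measure.pi fun _ : Fin 2 => unif a b).prod (Measure.pi fun _ : Fin 2 => coin))
          ((Set.univ.pi fun _ => {x | max |a| |b| / 2 < ((u : ℤ) : ℝ) * x}) ×ˢ
            (Set.univ.pi fun _ => {u})) := by
        rw [Measure.prod_prod, Measure.pi_pi, Measure.pi_pi]
    _ ≤ _ := measure_mono fun p hp => by
        simp only [Set.mem_preimage, Set.mem_singleton_iff, freeFlag, decide_eq_true_eq]
        intro j
        have h1 := hp.1 j trivial
        have h2 : p.2 j = u := hp.2 j trivial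
        simpa [h2] using h1

/-- The data of the middle vertices of the forest with edge weights `p.1` and cut `p.2`. -/
noncomputable def forestData {k m : ℕ} (a b : ℝ)
    (p : ((depthTwoForest k m).edgeSet → ℝ) × Cut (ForestVertex k m)) :
    Fin k × Fin 2 → Fin (2 * m) → MidData := fun τ s =>
  (p.1 (edgeEquiv k m ((τ, s), none)), relSide p.2 ((τ, s), none),
    freeFlag (max |a| |b|) (fun j => p.1 (edgeEquiv k m ((τ, s), some j)))
      (fun j => relSide p.2 ((τ, s), some j)))

/-- Taking the relative sides along all edges is a homomorphism of groups, surjective since a cut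
can be prescribed from the centers outwards. -/
lemma measurePreserving_relSide (k m : ℕ) :
    MeasurePreserving (fun σ : Cut (ForestVertex k m) => relSide σ) (uniformOn Set.univ)
      (Measure.pi fun _ => coin) := by
  have h : (Measure.pi fun _ : ChildIndex k m => coin) = uniformOn Set.univ := by
    rw [coin, ← uniformOn_pi, Set.pi_univ]
  rw [h]
  refine measurePreserving_uniformOn_of_surjective
    (⟨⟨fun σ => relSide σ, by ext; simp [relSide]⟩, fun σ σ' => by
      funext c; simp only [relSide, Pi.mul_apply]; exact mul_mul_mul_comm _ _ _ _⟩ :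
      Cut (ForestVertex k m) →* (ChildIndex k m → ℤˣ)) fun r => ?_
  refine ⟨fun v => match v with
    | (_, .center) => 1
    | (τ, .mid s) => r ((τ, s), none)
    | (τ, .leaf s j) => r ((τ, s), some j) * r ((τ, s), none), ?_⟩
  funext ⟨⟨τ, s⟩, o⟩
  rcases o with _ | j
  · simp [relSide, child, parent]
  · simp [relSide, child, parent, mul_assoc]

/-- The law of the data of one middle vertex is the image of that of the weights of the edges to
its neighbours and of their sides. -/
lemma measurePreserving_midData {a b : ℝ} (h : a < b) :
    MeasurePreserving (fun p : (Option (Fin 2) → ℝ) × (Option (Fin 2) → ℤˣ) =>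
        ((p.1 none, p.2 none, freeFlag (max |a| |b|) (fun j => p.1 (some j))
          (fun j => p.2 (some j))) : MidData))
      ((Measure.pi fun _ => unif a b).prod (Measure.pi fun _ => coin))
      (midLaw a b (flagLaw a b)) := by
  have := isProbabilityMeasure_unif h
  have := isProbabilityMeasure_flagLaw h
  have h₁ := (measurePreserving_option (ι := Fin 2) (unif a b)).prod
    (measurePreserving_option (ι := Fin 2) coin)
  have h₂ := (measurePreserving_prodProdProdComm (unif a b) (Measure.pi fun _ : Fin 2 => unif a b)
    coin (Measure.pi fun _ : Fin 2 => coin)).comp h₁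
  have h₃ : MeasurePreserving (fun p : (Fin 2 → ℝ) × (Fin 2 → ℤˣ) =>
      freeFlag (max |a| |b|) p.1 p.2)
      ((Measure.pi fun _ => unif a b).prod (Measure.pi fun _ => coin)) (flagLaw a b) :=
    ⟨measurable_freeFlag _, rfl⟩
  have h₄ := ((MeasurePreserving.id ((unif a b).prod coin)).prod h₃).comp h₂
  exact (measurePreserving_prodAssoc _ _ _).comp h₄

/-- The data of all middle vertices are independent. -/
lemma measurePreserving_forestData (k m : ℕ) {a b : ℝ} (h : a < b)
    [Fintype (depthTwoForest k m).edgeSet] :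
    MeasurePreserving (forestData a b) (randomInstance (depthTwoForest k m) a b)
      (Measure.pi fun _ => Measure.pi fun _ => midLaw a b (flagLaw a b)) := by
  have := isProbabilityMeasure_unif h
  have := isProbabilityMeasure_flagLaw h
  have h₁ := (measurePreserving_comp_equiv (unif a b) (edgeEquiv k m)).prod
    (measurePreserving_relSide k m)
  have h₂ := ((measurePreserving_curry (ι := (Fin k × Fin 2) × Fin (2 * m))
    (κ := Option (Fin 2)) (unif a b)).prod (measurePreserving_curry coin)).comp h₁
  have h₃ := (measurePreserving_zip _ _).comp h₂
  have h₄ := (measurePreserving_pi _ _ fun _ => measurePreserving_midData h).comp h₃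
  exact (measurePreserving_curry _).comp h₄

/-! ### Gains that can be reached in a tree -/

/-- `v` is a gain of the center that can be arranged by flipping some of the free middle
vertices. -/
def IsReachable {ι : Type*} [Fintype ι] (z : ι → MidData) (v : ℝ) : Prop :=
  ∃ ε : ι → ℤˣ, (∀ s, ε s = (z s).2.1 ∨ (z s).2.2 = true) ∧
    ∑ s, ((ε s : ℤ) : ℝ) * (z s).1 = v

section Reachable

variable {ι κ : Type*} [Fintype ι] [Fintype κ]

lemma IsReachable.of_comp_equiv {z : κ → MidData} {v : ℝ} (e : ι ≃ κ)
    (h : IsReachable (z ∘ e) v) : IsReachable z v := by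
  obtain ⟨ε, hε, rfl⟩ := h
  refine ⟨ε ∘ e.symm, fun s => by simpa using hε (e.symm s), ?_⟩
  rw [← Equiv.sum_comp e]
  simp

lemma IsReachable.prod {z : ι × κ → MidData} {v : ι → ℝ}
    (h : ∀ i, IsReachable (fun j => z (i, j)) (v i)) : IsReachable z (∑ i, v i) := by
  choose ε hε hv using h
  refine ⟨fun p => ε p.1 p.2, fun p => hε p.1 p.2, ?_⟩
  rw [Fintype.sum_prod_type]
  exact Finset.sum_congr rfl fun i _ => hv i

lemma IsReachable.sum {z : ι ⊕ κ → MidData} {v w : ℝ} (hv : IsReachable (fun i => z (.inl i)) v)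
    (hw : IsReachable (fun j => z (.inr j)) w) : IsReachable z (v + w) := by
  obtain ⟨ε, hε, rfl⟩ := hv
  obtain ⟨δ, hδ, rfl⟩ := hw
  refine ⟨Sum.elim ε δ, ?_, by simp⟩
  rintro (i | j)
  exacts [hε i, hδ j]

lemma IsReachable.option {z : Option ι → MidData} {w : ℝ} (h0 : (z none).2.2 = true)
    (hw : IsReachable (fun j => z (some j)) w) : IsReachable z (w + (z none).1) := by
  obtain ⟨ε, hε, rfl⟩ := hw
  refine ⟨fun o => o.elim 1 ε, ?_, by simp [add_comm]⟩
  rintro (_ | i)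
  exacts [Or.inr h0, hε i]

end Reachable

/-- The data of four middle vertices. -/
abbrev Quad := Fin 4 → MidData

namespace Quad

/-- All four middle vertices are free. -/
def Free (q : Quad) : Prop := ∀ i, (q i).2.2 = true

instance (q : Quad) : Decidable q.Free := inferInstanceAs (Decidable (∀ i, (q i).2.2 = true))

/-- The distance between the first two weights. -/
def dist₁ (q : Quad) : ℝ := |(q 0).1 - (q 1).1|

/-- The distance between the last two weights. -/
def dist₂ (q : Quad) : ℝ := |(q 2).1 - (q 3).1|

/-- The contribution to the gain of the center of a quadruple that is not free, as given by the
initial cut. -/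
def fixedPart (q : Quad) : ℝ := if q.Free then 0 else ∑ i, (((q i).2.1 : ℤ) : ℝ) * (q i).1

end Quad

/-- The sign of a real number, with value `1` at `0`. -/
noncomputable def signUnit (x : ℝ) : ℤˣ := if 0 ≤ x then 1 else -1

lemma signUnit_mul_self (x : ℝ) : ((signUnit x : ℤ) : ℝ) * x = |x| := by
  unfold signUnit
  split_ifs with h
  · simp [abs_of_nonneg h]
  · simp [abs_of_neg (not_le.1 h)]

lemma exists_unit_mul_abs (x : ℝ) : ∃ u : ℤˣ, |x| = ((u : ℤ) : ℝ) * x :=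
  ⟨signUnit x, (signUnit_mul_self x).symm⟩

/-- A step towards `0` by the sum of the two distances, if the quadruple is free. -/
noncomputable def steerStep (q : Quad) (x : ℝ) : ℝ :=
  if q.Free then x - ((signUnit x : ℤ) : ℝ) * (q.dist₁ + q.dist₂) else x

/-- A step towards `0` by the larger of the two distances and a step by the smaller one in a
prescribed direction, if the quadruple is free. -/
noncomputable def chainStep (p : Quad × ℤˣ) (x : ℝ) : ℝ :=
  if p.1.Free then x - ((signUnit x : ℤ) : ℝ) * max p.1.dist₁ p.1.dist₂ +
    ((p.2 : ℤ) : ℝ) * min p.1.dist₁ p.1.dist₂ else x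

/-- The result of performing the steps `f (c 0)`, `f (c 1)`, …, in this order, from `x`. -/
def foldSteps {α : Type*} (f : α → ℝ → ℝ) : {N : ℕ} → (Fin N → α) → ℝ → ℝ
  | 0, _, x => x
  | _ + 1, c, x => foldSteps f (fun i => c i.succ) (f (c 0) x)

lemma isReachable_dist {q : Quad} (hq : q.Free) (u u' : ℤˣ) :
    IsReachable q (((u : ℤ) : ℝ) * q.dist₁ + ((u' : ℤ) : ℝ) * q.dist₂) := by
  obtain ⟨s, hs⟩ := exists_unit_mul_abs ((q 0).1 - (q 1).1)
  obtain ⟨s', hs'⟩ := exists_unit_mul_abs ((q 2).1 - (q 3).1)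
  refine ⟨![u * s, -(u * s), u' * s', -(u' * s')], fun i => Or.inr (hq i), ?_⟩
  rw [Quad.dist₁, Quad.dist₂, hs, hs']
  simp [Fin.sum_univ_four]
  ring

lemma isReachable_fixedPart {q : Quad} (hq : ¬ q.Free) : IsReachable q q.fixedPart :=
  ⟨fun i => (q i).2.1, fun _ => Or.inl rfl, by rw [Quad.fixedPart, if_neg hq]⟩

lemma isReachable_steerStep (q : Quad) (x : ℝ) :
    IsReachable q (q.fixedPart + (steerStep q x - x)) := by
  by_cases hq : q.Free
  · convert! isReachable_dist hq (-signUnit x) (-signUnit x) using 1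
    simp only [Quad.fixedPart, steerStep, if_pos hq, Units.val_neg, Int.cast_neg]
    ring
  · simpa [steerStep, hq] using isReachable_fixedPart hq

lemma isReachable_chainStep (p : Quad × ℤˣ) (x : ℝ) :
    IsReachable p.1 (p.1.fixedPart + (chainStep p x - x)) := by
  by_cases hq : p.1.Free
  · rcases le_total p.1.dist₁ p.1.dist₂ with h | h
    · convert! isReachable_dist hq p.2 (-signUnit x) using 1
      simp only [Quad.fixedPart, chainStep, if_pos hq, Units.val_neg, Int.cast_neg, max_eq_right h,
        min_eq_left h]
      ring
    · convert! isReachable_dist hq (-signUnit x) p.2 using 1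
      simp only [Quad.fixedPart, chainStep, if_pos hq, Units.val_neg, Int.cast_neg, max_eq_left h,
        min_eq_right h]
      ring
  · simpa [chainStep, hq] using isReachable_fixedPart hq

/-- The displacement that results from a sequence of steps, together with the fixed contributions,
is reachable. The choices made in a step may depend on the position `x`. -/
lemma isReachable_foldSteps {α : Type*} {f : α → ℝ → ℝ} {g : α → Quad}
    (hf : ∀ p x, IsReachable (g p) ((g p).fixedPart + (f p x - x))) {N : ℕ} (c : Fin N → α)
    (x : ℝ) :
    IsReachable (fun p : Fin N × Fin 4 => g (c p.1) p.2)
      (∑ i, (g (c i)).fixedPart + (foldSteps f c x - x)) := by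
  suffices h : ∃ v : Fin N → ℝ, (∀ i, IsReachable (g (c i)) (v i)) ∧
      ∑ i, v i = ∑ i, (g (c i)).fixedPart + (foldSteps f c x - x) by
    obtain ⟨v, hv, h⟩ := h
    rw [← h]
    exact IsReachable.prod hv
  induction N generalizing x with
  | zero => exact ⟨fun _ => 0, fun i => i.elim0, by simp [foldSteps]⟩
  | succ N ih =>
    obtain ⟨v, hv, h⟩ := ih (fun i => c i.succ) (f (c 0) x)
    refine ⟨Fin.cons ((g (c 0)).fixedPart + (f (c 0) x - x)) v, ?_, ?_⟩
    · intro i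
      refine Fin.cases ?_ (fun i => ?_) i
      · simpa using hf (c 0) x
      · simpa using hv i
    · simp only [Fin.sum_univ_succ, Fin.cons_zero, Fin.cons_succ, h, foldSteps]
      ring

/-! ### Deterministic bounds for the steps -/

/-- All weights lie in `[a, b]`. -/
def WeightsIn {ι : Type*} (a b : ℝ) (z : ι → MidData) : Prop := ∀ i, (z i).1 ∈ Set.Icc a b

lemma Quad.dist₁_le {a b : ℝ} {q : Quad} (h : WeightsIn a b q) : q.dist₁ ≤ b - a :=
  abs_sub_le_of_le_of_le (h 0).1 (h 0).2 (h 1).1 (h 1).2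

lemma Quad.dist₂_le {a b : ℝ} {q : Quad} (h : WeightsIn a b q) : q.dist₂ ≤ b - a :=
  abs_sub_le_of_le_of_le (h 2).1 (h 2).2 (h 3).1 (h 3).2

lemma abs_sub_signUnit_mul (x y : ℝ) : |x - ((signUnit x : ℤ) : ℝ) * y| = |(|x| - y)| := by
  unfold signUnit
  split_ifs with h
  · simp [abs_of_nonneg h]
  · rw [abs_of_neg (not_le.1 h), ← abs_neg]
    congr 1
    simp
    ring

lemma abs_unit_mul (u : ℤˣ) (x : ℝ) : |((u : ℤ) : ℝ) * x| = |x| := by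
  rcases Int.units_eq_one_or u with rfl | rfl <;> simp

lemma abs_chainStep_le {D x : ℝ} {p : Quad × ℤˣ} (h₁ : p.1.dist₁ ≤ D) (h₂ : p.1.dist₂ ≤ D)
    (hx : |x| ≤ 2 * D) : |chainStep p x| ≤ 2 * D := by
  unfold chainStep
  split_ifs
  · refine (abs_add_le _ _).trans ?_
    rw [abs_sub_signUnit_mul, abs_unit_mul]
    have hM : max p.1.dist₁ p.1.dist₂ ≤ D := max_le h₁ h₂
    have hm : min p.1.dist₁ p.1.dist₂ ≤ max p.1.dist₁ p.1.dist₂ := min_le_max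
    have h0 : 0 ≤ min p.1.dist₁ p.1.dist₂ := le_min (abs_nonneg _) (abs_nonneg _)
    rw [abs_of_nonneg h0]
    rcases abs_cases (|x| - max p.1.dist₁ p.1.dist₂) with h | h <;> linarith [abs_nonneg x]
  · exact hx

/-- The chain stays bounded, whatever the directions of the small steps. -/
lemma abs_foldSteps_chainStep_le {D x : ℝ} {N : ℕ} {c : Fin N → Quad × ℤˣ}
    (h₁ : ∀ i, (c i).1.dist₁ ≤ D) (h₂ : ∀ i, (c i).1.dist₂ ≤ D) (hx : |x| ≤ 2 * D) :
    |foldSteps chainStep c x| ≤ 2 * D := by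
  induction N generalizing x with
  | zero => exact hx
  | succ N ih => exact ih (fun i => h₁ _) (fun i => h₂ _) (abs_chainStep_le (h₁ 0) (h₂ 0) hx)

/-- The length of the step `steerStep q`. -/
def Quad.steerLength (q : Quad) : ℝ := if q.Free then q.dist₁ + q.dist₂ else 0

lemma Quad.steerLength_nonneg (q : Quad) : 0 ≤ q.steerLength := by
  unfold steerLength
  split_ifs
  exacts [add_nonneg (abs_nonneg _) (abs_nonneg _), le_rfl]

lemma abs_steerStep (q : Quad) (x : ℝ) : |steerStep q x| = |(|x| - q.steerLength)| := by
  unfold steerStep Quad.steerLength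
  split_ifs
  · exact abs_sub_signUnit_mul _ _
  · simp

/-- Steps towards `0` of length at most `D` end in `[-D, D]` if their lengths add up to enough. -/
lemma abs_foldSteps_steerStep_le {D x : ℝ} {N : ℕ} {c : Fin N → Quad}
    (h : ∀ i, (c i).steerLength ≤ D) (hx : |x| ≤ D + ∑ i, (c i).steerLength) :
    |foldSteps steerStep c x| ≤ D := by
  induction N generalizing x with
  | zero => simpa [foldSteps] using hx
  | succ N ih =>
    refine ih (fun i => h _) ?_
    rw [abs_steerStep]
    rw [Fin.sum_univ_succ] at hx
    have h0 := h 0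
    have hs : 0 ≤ ∑ i : Fin N, (c i.succ).steerLength :=
      Finset.sum_nonneg fun i _ => (c i.succ).steerLength_nonneg
    rcases abs_cases (|x| - (c 0).steerLength) with h' | h' <;> linarith [abs_nonneg x]

lemma Quad.steerLength_le {a b : ℝ} (hab : a ≤ b) {q : Quad} (h : WeightsIn a b q) :
    q.steerLength ≤ 2 * (b - a) := by
  unfold steerLength
  split_ifs
  · linarith [dist₁_le h, dist₂_le h]
  · linarith

lemma Quad.abs_fixedPart_le {a b : ℝ} {q : Quad} (h : WeightsIn a b q) :
    |q.fixedPart| ≤ 4 * max |a| |b| := by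
  unfold fixedPart
  split_ifs
  · simp
  · refine (Finset.abs_sum_le_sum_abs _ _).trans ?_
    refine (Finset.sum_le_card_nsmul _ _ (max |a| |b|) fun i _ => ?_).trans (by simp)
    rw [abs_unit_mul]
    exact abs_le_max_abs_abs (h i).1 (h i).2

/-! ### Measurability -/

lemma measurable_unit_cast : Measurable fun u : ℤˣ => ((u : ℤ) : ℝ) := measurable_of_finite _

lemma measurable_signUnit : Measurable signUnit :=
  Measurable.ite measurableSet_Ici measurable_const measurable_const

lemma Quad.measurableSet_free : MeasurableSet {q : Quad | q.Free} := by
  simp only [Quad.Free, Set.ofPred_forall]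
  refine MeasurableSet.iInter fun i => ?_
  exact (measurableSet_singleton true).preimage
    (measurable_snd.comp (measurable_snd.comp (measurable_pi_apply i)))

lemma Quad.measurable_dist₁ : Measurable Quad.dist₁ := by
  unfold Quad.dist₁
  fun_prop

lemma Quad.measurable_dist₂ : Measurable Quad.dist₂ := by
  unfold Quad.dist₂
  fun_prop

lemma Quad.measurable_steerLength : Measurable Quad.steerLength :=
  Measurable.ite measurableSet_free (measurable_dist₁.add measurable_dist₂) measurable_const

lemma Quad.measurable_fixedPart : Measurable Quad.fixedPart := by
  refine Measurable.ite measurableSet_free measurable_const ?_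
  refine Finset.measurable_sum _ fun i _ => Measurable.mul ?_ (by fun_prop)
  exact measurable_unit_cast.comp (by fun_prop)

lemma measurable_steerStep : Measurable fun p : Quad × ℝ => steerStep p.1 p.2 := by
  refine Measurable.ite (Quad.measurableSet_free.preimage measurable_fst) ?_ measurable_snd
  have h₁ : Measurable fun p : Quad × ℝ => ((signUnit p.2 : ℤ) : ℝ) :=
    measurable_unit_cast.comp (measurable_signUnit.comp measurable_snd)
  have h₂ : Measurable fun p : Quad × ℝ => p.1.dist₁ := Quad.measurable_dist₁.comp measurable_fst
  have h₃ : Measurable fun p : Quad × ℝ => p.1.dist₂ := Quad.measurable_dist₂.comp measurable_fst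
  exact measurable_snd.sub (h₁.mul (h₂.add h₃))

lemma measurable_chainStep :
    Measurable fun p : (Quad × ℤˣ) × ℝ => chainStep p.1 p.2 := by
  refine Measurable.ite (Quad.measurableSet_free.preimage (measurable_fst.comp measurable_fst)) ?_
    measurable_snd
  have h₁ : Measurable fun p : (Quad × ℤˣ) × ℝ => ((signUnit p.2 : ℤ) : ℝ) :=
    measurable_unit_cast.comp (measurable_signUnit.comp measurable_snd)
  have hq : Measurable fun p : (Quad × ℤˣ) × ℝ => p.1.1 := by fun_prop
  have h₂ := Quad.measurable_dist₁.comp hq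
  have h₃ := Quad.measurable_dist₂.comp hq
  have h₄ : Measurable fun p : (Quad × ℤˣ) × ℝ => ((p.1.2 : ℤ) : ℝ) :=
    measurable_unit_cast.comp (by fun_prop)
  exact (measurable_snd.sub (h₁.mul (h₂.max h₃))).add (h₄.mul (h₂.min h₃))

lemma measurable_foldSteps {α : Type*} [MeasurableSpace α] {f : α → ℝ → ℝ}
    (hf : Measurable fun p : α × ℝ => f p.1 p.2) {N : ℕ} :
    Measurable fun p : (Fin N → α) × ℝ => foldSteps f p.1 p.2 := by
  induction N with
  | zero => exact measurable_snd
  | succ N ih =>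
    have h : Measurable fun p : (Fin (N + 1) → α) × ℝ =>
        ((fun i => p.1 i.succ : Fin N → α), f (p.1 0) p.2) := by
      refine Measurable.prodMk (by fun_prop) (hf.comp (f := fun p : (Fin (N + 1) → α) × ℝ =>
        (p.1 0, p.2)) (by fun_prop))
    exact ih.comp h

/-! ### Collisions of the chain -/

section Collision

variable {a b : ℝ} {γ : Measure Bool} [IsProbabilityMeasure γ]

instance [h : Fact (a < b)] : IsProbabilityMeasure (unif a b) :=
  isProbabilityMeasure_unif h.out

lemma unif_le (h : a < b) (s : Set ℝ) :
    unif a b s ≤ ENNReal.ofReal (b - a)⁻¹ * volume s := by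
  rw [unif_apply h]
  gcongr
  exact Set.inter_subset_right

lemma unif_abs_linear_le (h : a < b) {e : ℝ} (he : 2 ≤ |e|) (D δ : ℝ) :
    unif a b {w | |D + e * w| ≤ δ} ≤ ENNReal.ofReal (δ / (b - a)) := by
  have hne : e ≠ 0 := fun h0 => by norm_num [h0] at he
  calc unif a b {w | |D + e * w| ≤ δ}
      ≤ ENNReal.ofReal (b - a)⁻¹ * volume {w | |D + e * w| ≤ δ} := unif_le h _
    _ ≤ ENNReal.ofReal (b - a)⁻¹ * volume (Metric.closedBall (-D / e) (δ / 2)) := by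
        gcongr
        intro w (hw : |D + e * w| ≤ δ)
        have h1 : w - -D / e = (D + e * w) / e := by field_simp; ring
        rw [Metric.mem_closedBall, Real.dist_eq, h1, abs_div, div_le_div_iff₀ (by positivity)
          (by norm_num)]
        nlinarith [abs_nonneg (D + e * w)]
    _ = ENNReal.ofReal (δ / (b - a)) := by
        rw [Real.volume_closedBall, ← ENNReal.ofReal_mul (by simp [h.le])]
        congr 1
        ring

variable (a b γ) in
/-- The law of the data of four middle vertices. -/
noncomputable abbrev quadLaw : Measure Quad := Measure.pi fun _ => midLaw a b γ

/-- A linear form in independent uniform weights with one large coefficient is unlikely to lie in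
a short interval: fix all other weights. -/
lemma pi_abs_linear_le [h : Fact (a < b)] {n : ℕ} (e : Fin (n + 1) → ℝ) {i : Fin (n + 1)}
    (hi : 2 ≤ |e i|) (D δ : ℝ) :
    (Measure.pi fun _ => midLaw a b γ) {z : Fin (n + 1) → MidData |
      |D + ∑ j, e j * (z j).1| ≤ δ} ≤ ENNReal.ofReal (δ / (b - a)) := by
  have hmp := measurePreserving_piFinSuccAbove (fun _ : Fin (n + 1) => midLaw a b γ) i
  set S : Set (MidData × (Fin n → MidData)) :=
    {p | |(D + ∑ j, e (i.succAbove j) * (p.2 j).1) + e i * p.1.1| ≤ δ} with hS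
  have hSm : MeasurableSet S := by
    refine measurableSet_le (Measurable.comp continuous_abs.measurable ?_) measurable_const
    fun_prop
  have hpre : {z : Fin (n + 1) → MidData | |D + ∑ j, e j * (z j).1| ≤ δ} =
      (MeasurableEquiv.piFinSuccAbove (fun _ => MidData) i) ⁻¹' S := by
    ext z
    simp only [hS, Set.mem_ofPred_eq, Set.mem_preimage, Fin.sum_univ_succAbove _ i]
    rw [add_comm (e i * _), ← add_assoc]
    rfl
  rw [hpre, hmp.measure_preimage_equiv, Measure.prod_apply_symm hSm]
  calc ∫⁻ y, midLaw a b γ ((fun x => (x, y)) ⁻¹' S) ∂(Measure.pi fun _ => midLaw a b γ)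
      ≤ ∫⁻ _, ENNReal.ofReal (δ / (b - a)) ∂(Measure.pi fun _ : Fin n => midLaw a b γ) := by
        refine lintegral_mono fun y => ?_
        refine (measure_mono (t := {w | |(D + ∑ j, e (i.succAbove j) * (y j).1) + e i * w| ≤ δ} ×ˢ
          Set.univ) fun x hx => ⟨hx, trivial⟩).trans ?_
        rw [Measure.prod_prod, measure_univ, mul_one]
        exact unif_abs_linear_le h.out hi _ _
    _ = ENNReal.ofReal (δ / (b - a)) := by simp

/-- The larger and the smaller distance are jointly so spread out that a linear form in them is
unlikely to lie in a short interval. -/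
lemma quadLaw_abs_dist_le [h : Fact (a < b)] {e f : ℝ} (hef : 2 ≤ |e| ∨ 2 ≤ |f|) (D δ : ℝ) :
    quadLaw a b γ {q | |D + e * max q.dist₁ q.dist₂ + f * min q.dist₁ q.dist₂| ≤ δ} ≤
      8 * ENNReal.ofReal (δ / (b - a)) := by
  -- the distances are linear forms in the weights on each of eight pieces
  have key : ∀ e f : ℝ, 2 ≤ |e| ∨ 2 ≤ |f| →
      quadLaw a b γ {q | |D + (e * ((q 0).1 - (q 1).1) + f * ((q 2).1 - (q 3).1))| ≤ δ} ≤
        ENNReal.ofReal (δ / (b - a)) := by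
    intro e f hef
    have hsum : ∀ q : Quad, e * ((q 0).1 - (q 1).1) + f * ((q 2).1 - (q 3).1) =
        ∑ j, (![e, -e, f, -f] : Fin 4 → ℝ) j * (q j).1 := fun q => by
      simp [Fin.sum_univ_four]
      ring
    simp only [hsum]
    rcases hef with he | hf
    · exact pi_abs_linear_le (i := 0) _ (by simpa using he) D δ
    · exact pi_abs_linear_le (i := 2) _ (by simpa using hf) D δ
  let E : ℤˣ × ℤˣ × Bool → Set Quad := fun p =>
    {q | |D + (((p.1 : ℤ) : ℝ) * (if p.2.2 then e else f) * ((q 0).1 - (q 1).1) +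
      ((p.2.1 : ℤ) : ℝ) * (if p.2.2 then f else e) * ((q 2).1 - (q 3).1))| ≤ δ}
  calc quadLaw a b γ {q | |D + e * max q.dist₁ q.dist₂ + f * min q.dist₁ q.dist₂| ≤ δ}
      ≤ quadLaw a b γ (⋃ p, E p) := by
        refine measure_mono fun q hq => ?_
        obtain ⟨u, hu⟩ := exists_unit_mul_abs ((q 0).1 - (q 1).1)
        obtain ⟨u', hu'⟩ := exists_unit_mul_abs ((q 2).1 - (q 3).1)
        rw [Set.mem_ofPred_eq] at hq
        rcases le_total q.dist₁ q.dist₂ with hle | hle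
        · refine Set.mem_iUnion.2 ⟨(u, u', false), ?_⟩
          rw [max_eq_right hle, min_eq_left hle, Quad.dist₁, Quad.dist₂, hu, hu'] at hq
          simp only [E, Set.mem_ofPred_eq, Bool.false_eq_true, if_false]
          convert hq using 2
          ring
        · refine Set.mem_iUnion.2 ⟨(u, u', true), ?_⟩
          rw [max_eq_left hle, min_eq_right hle, Quad.dist₁, Quad.dist₂, hu, hu'] at hq
          simp only [E, Set.mem_ofPred_eq, if_true]
          convert hq using 2
          ring
    _ ≤ ∑ p, quadLaw a b γ (E p) := measure_iUnion_fintype_le _ _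
    _ ≤ ∑ _p : ℤˣ × ℤˣ × Bool, ENNReal.ofReal (δ / (b - a)) := by
        refine Finset.sum_le_sum fun p _ => key _ _ ?_
        simp only [abs_unit_mul]
        split_ifs
        exacts [hef, hef.symm]
    _ = 8 * ENNReal.ofReal (δ / (b - a)) := by
        simp [Fintype.card_prod]

/-- The rate at which the chain separates the positions that belong to different directions of
the small steps. It is `1 - π / 2`, where `π` is a lower bound for the probability that a quadruple
is free: a step separates two chains whenever the quadruple is free and their directions differ, and
half of the pairs of directions differ. -/
noncomputable def chainRate : ℝ := 1 - (1 / 64) ^ 4 / 2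

lemma quadLaw_not_free_le [h : Fact (a < b)] (hγ : ENNReal.ofReal (1 / 64) ≤ γ {true}) :
    quadLaw a b γ {q | ¬ q.Free} ≤ ENNReal.ofReal (1 - (1 / 64) ^ 4) := by
  have h1 : ENNReal.ofReal ((1 / 64) ^ 4) ≤ quadLaw a b γ {q | q.Free} := by
    calc ENNReal.ofReal ((1 / 64) ^ 4) = ∏ _i : Fin 4, ENNReal.ofReal (1 / 64) := by
          rw [Finset.prod_const, ENNReal.ofReal_pow (by norm_num)]
          simp
      _ ≤ ∏ _i : Fin 4, midLaw a b γ (Set.univ ×ˢ (Set.univ ×ˢ {true})) := by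
          gcongr
          rw [Measure.prod_prod, Measure.prod_prod]
          simpa using hγ
      _ = quadLaw a b γ (Set.univ.pi fun _ => Set.univ ×ˢ (Set.univ ×ˢ {true})) :=
          (Measure.pi_pi _ _).symm
      _ ≤ _ := measure_mono fun q hq i => (hq i trivial).2.2
  have h2 : {q : Quad | ¬ q.Free} = {q : Quad | q.Free}ᶜ := rfl
  rw [h2, prob_compl_eq_one_sub Quad.measurableSet_free, ENNReal.ofReal_sub _ (by positivity),
    ENNReal.ofReal_one]
  gcongr

/-- The probability that the positions of two chains are within distance `δ` after one step. -/
lemma sum_quadLaw_chainStep_le [h : Fact (a < b)] (hγ : ENNReal.ofReal (1 / 64) ≤ γ {true})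
    (x y δ : ℝ) :
    ∑ β : ℤˣ, ∑ β' : ℤˣ,
      quadLaw a b γ {q | |chainStep (q, β) x - chainStep (q, β') y| ≤ δ} ≤
    4 * (8 * ENNReal.ofReal (δ / (b - a)) +
      ENNReal.ofReal chainRate * {p : ℝ × ℝ | |p.1 - p.2| ≤ δ}.indicator 1 (x, y)) := by
  set I : ENNReal := {p : ℝ × ℝ | |p.1 - p.2| ≤ δ}.indicator 1 (x, y) with hI
  set K : ENNReal := 8 * ENNReal.ofReal (δ / (b - a)) with hK
  set P : ENNReal := ENNReal.ofReal (1 - (1 / 64) ^ 4) with hP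
  -- If the signs of `x` and `y` or the directions differ, a free quadruple displaces `x - y` by a
  -- nonzero linear form in its distances.
  have hmain : ∀ β β' : ℤˣ, (signUnit x ≠ signUnit y ∨ β ≠ β') →
      quadLaw a b γ {q | |chainStep (q, β) x - chainStep (q, β') y| ≤ δ} ≤ K + P * I := by
    intro β β' hne
    have hsub : {q | |chainStep (q, β) x - chainStep (q, β') y| ≤ δ} ⊆
        {q | |(x - y) + (((signUnit y : ℤ) : ℝ) - ((signUnit x : ℤ) : ℝ)) *
            max q.dist₁ q.dist₂ + (((β : ℤ) : ℝ) - ((β' : ℤ) : ℝ)) * min q.dist₁ q.dist₂| ≤ δ} ∪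
          {q | ¬ q.Free ∧ |x - y| ≤ δ} := by
      intro q hq
      rw [Set.mem_ofPred_eq] at hq
      by_cases hf : q.Free
      · left
        simp only [chainStep, if_pos hf] at hq
        rw [Set.mem_ofPred_eq]
        convert hq using 2
        ring
      · right
        simp only [chainStep, if_neg hf] at hq
        exact ⟨hf, hq⟩
    refine (measure_mono hsub).trans ((measure_union_le _ _).trans (add_le_add ?_ ?_))
    · refine quadLaw_abs_dist_le ?_ _ _
      rcases hne with h | h
      · left
        rcases Int.units_eq_one_or (signUnit x) with h1 | h1 <;>
          rcases Int.units_eq_one_or (signUnit y) with h2 | h2 <;> simp_all <;> norm_num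
      · right
        rcases Int.units_eq_one_or β with h1 | h1 <;>
          rcases Int.units_eq_one_or β' with h2 | h2 <;> simp_all <;> norm_num
    · by_cases hxy : |x - y| ≤ δ
      · have : I = 1 := Set.indicator_of_mem (s := {p : ℝ × ℝ | |p.1 - p.2| ≤ δ}) hxy _
        simp only [hxy, and_true, this, mul_one]
        exact quadLaw_not_free_le hγ
      · simp [hxy]
  have hP1 : P ≤ 1 := by
    rw [hP, ← ENNReal.ofReal_one]
    exact ENNReal.ofReal_le_ofReal (by norm_num)
  -- If neither differ, the two chains move in parallel.
  have hdiag : ∀ β : ℤˣ,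
      quadLaw a b γ {q | |chainStep (q, β) x - chainStep (q, β) y| ≤ δ} ≤ K + 1 * I := by
    intro β
    by_cases hs : signUnit x = signUnit y
    · have heq : ∀ q : Quad, chainStep (q, β) x - chainStep (q, β) y = x - y := fun q => by
        unfold chainStep
        split_ifs
        · rw [hs]; ring
        · rfl
      simp only [heq]
      by_cases hxy : |x - y| ≤ δ
      · have : I = 1 := Set.indicator_of_mem (s := {p : ℝ × ℝ | |p.1 - p.2| ≤ δ}) hxy _
        simp only [hxy, this, mul_one]
        exact prob_le_one.trans le_add_self
      · simp [hxy]
    · exact (hmain β β (Or.inl hs)).trans (by gcongr)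
  have huniv : (Finset.univ : Finset ℤˣ) = {1, -1} := rfl
  have hrate : ENNReal.ofReal chainRate * 4 = 2 * 1 + 2 * P := by
    rw [hP, show (4 : ENNReal) = ENNReal.ofReal 4 by simp,
      show (2 : ENNReal) = ENNReal.ofReal 2 by simp, mul_one,
      ← ENNReal.ofReal_mul (by norm_num [chainRate]), ← ENNReal.ofReal_mul (by norm_num),
      ← ENNReal.ofReal_add (by norm_num) (by norm_num)]
    congr 1
    norm_num [chainRate]
  rw [huniv, Finset.sum_pair (by decide), Finset.sum_pair (by decide),
    Finset.sum_pair (by decide)]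
  calc _ ≤ ((K + 1 * I) + (K + P * I)) + ((K + P * I) + (K + 1 * I)) :=
        add_le_add (add_le_add (hdiag 1) (hmain 1 (-1) (Or.inr (by decide))))
          (add_le_add (hmain (-1) 1 (Or.inr (by decide))) (hdiag (-1)))
    _ = 4 * K + (2 * 1 + 2 * P) * I := by ring
    _ = 4 * (K + ENNReal.ofReal chainRate * I) := by rw [← hrate]; ring

lemma sum_pi_cons {N : ℕ} (F : (Fin (N + 1) → ℤˣ) → ENNReal) :
    ∑ β, F β = ∑ β₀, ∑ β : Fin N → ℤˣ, F (Fin.cons β₀ β) := by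
  rw [← Equiv.sum_comp (Fin.consEquiv fun _ => ℤˣ), Fintype.sum_prod_type]
  rfl

/-- The position of the chain after all its steps. -/
noncomputable def chainEnd {N : ℕ} (c : Fin N → Quad) (β : Fin N → ℤˣ) (x : ℝ) : ℝ :=
  foldSteps chainStep (fun i => (c i, β i)) x

lemma measurable_chainEnd {N : ℕ} (β : Fin N → ℤˣ) :
    Measurable fun p : (Fin N → Quad) × ℝ => chainEnd p.1 β p.2 := by
  have h : Measurable fun p : (Fin N → Quad) × ℝ => ((fun i => (p.1 i, β i)), p.2) := by
    fun_prop
  exact (measurable_foldSteps measurable_chainStep).comp h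

/-- Averaged over the directions `β` and `β'` of the small steps, the positions of the two chains
are rarely within distance `δ`. -/
lemma sum_collision_le [h : Fact (a < b)] (hγ : ENNReal.ofReal (1 / 64) ≤ γ {true}) (δ : ℝ)
    (N : ℕ) (x y : ℝ) :
    ∑ β : Fin N → ℤˣ, ∑ β' : Fin N → ℤˣ, (Measure.pi fun _ : Fin N => quadLaw a b γ)
      {c | |chainEnd c β x - chainEnd c β' y| ≤ δ} ≤
    4 ^ N * (8 * ENNReal.ofReal (δ / (b - a)) *
        ∑ j ∈ Finset.range N, ENNReal.ofReal chainRate ^ j +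
      ENNReal.ofReal chainRate ^ N * {p : ℝ × ℝ | |p.1 - p.2| ≤ δ}.indicator 1 (x, y)) := by
  induction N generalizing x y with
  | zero =>
    by_cases hxy : |x - y| ≤ δ <;> simp [chainEnd, foldSteps, hxy]
  | succ N ih =>
    set K : ENNReal := 8 * ENNReal.ofReal (δ / (b - a)) with hK
    set ρ : ENNReal := ENNReal.ofReal chainRate with hρ
    set ν := Measure.pi fun _ : Fin N => quadLaw a b γ with hν
    have hm₀ : ∀ (β₀ : ℤˣ) (x : ℝ), Measurable fun q : Quad => chainStep (q, β₀) x :=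
      fun β₀ x => measurable_chainStep.comp (f := fun q : Quad => ((q, β₀), x)) (by fun_prop)
    have hm : ∀ (β₀ : ℤˣ) (β : Fin N → ℤˣ) (x : ℝ), Measurable
        fun p : Quad × (Fin N → Quad) => chainEnd p.2 β (chainStep (p.1, β₀) x) :=
      fun β₀ β x => (measurable_chainEnd β).comp
        (measurable_snd.prodMk ((hm₀ β₀ x).comp measurable_fst))
    have hSm : ∀ (β₀ β₀' : ℤˣ) (β β' : Fin N → ℤˣ), MeasurableSet {p : Quad × (Fin N → Quad) |
        |chainEnd p.2 β (chainStep (p.1, β₀) x) - chainEnd p.2 β' (chainStep (p.1, β₀') y)| ≤ δ} :=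
      fun β₀ β₀' β β' => measurableSet_le (Measurable.comp continuous_abs.measurable
        ((hm β₀ β x).sub (hm β₀' β' y))) measurable_const
    have hstep : ∀ (β₀ β₀' : ℤˣ) (β β' : Fin N → ℤˣ),
        (Measure.pi fun _ : Fin (N + 1) => quadLaw a b γ)
          {c | |chainEnd c (Fin.cons β₀ β : Fin (N + 1) → ℤˣ) x -
            chainEnd c (Fin.cons β₀' β' : Fin (N + 1) → ℤˣ) y| ≤ δ} =
        ∫⁻ q, ν {c | |chainEnd c β (chainStep (q, β₀) x) -
          chainEnd c β' (chainStep (q, β₀') y)| ≤ δ} ∂quadLaw a b γ := by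
      intro β₀ β₀' β β'
      have hmp := measurePreserving_piFinSuccAbove (fun _ : Fin (N + 1) => quadLaw a b γ) 0
      exact (hmp.measure_preimage_equiv _).trans (Measure.prod_apply (hSm β₀ β₀' β β'))
    rw [sum_pi_cons]
    simp only [sum_pi_cons (N := N), hstep]
    calc ∑ β₀ : ℤˣ, ∑ β : Fin N → ℤˣ, ∑ β₀' : ℤˣ, ∑ β' : Fin N → ℤˣ,
          ∫⁻ q, ν {c | |chainEnd c β (chainStep (q, β₀) x) -
            chainEnd c β' (chainStep (q, β₀') y)| ≤ δ} ∂quadLaw a b γ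
        = ∑ β₀ : ℤˣ, ∑ β₀' : ℤˣ, ∑ β : Fin N → ℤˣ, ∑ β' : Fin N → ℤˣ,
          ∫⁻ q, ν {c | |chainEnd c β (chainStep (q, β₀) x) -
            chainEnd c β' (chainStep (q, β₀') y)| ≤ δ} ∂quadLaw a b γ :=
          Finset.sum_congr rfl fun β₀ _ => Finset.sum_comm
      _ = ∑ β₀ : ℤˣ, ∑ β₀' : ℤˣ, ∫⁻ q, ∑ β : Fin N → ℤˣ, ∑ β' : Fin N → ℤˣ,
          ν {c | |chainEnd c β (chainStep (q, β₀) x) -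
            chainEnd c β' (chainStep (q, β₀') y)| ≤ δ} ∂quadLaw a b γ := by
          refine Finset.sum_congr rfl fun β₀ _ => Finset.sum_congr rfl fun β₀' _ => ?_
          have hme : ∀ β β' : Fin N → ℤˣ, Measurable fun q : Quad =>
              ν {c | |chainEnd c β (chainStep (q, β₀) x) -
                chainEnd c β' (chainStep (q, β₀') y)| ≤ δ} := fun β β' =>
            measurable_measure_prodMk_left (hSm β₀ β₀' β β')
          rw [lintegral_finsetSum _ fun β _ => Finset.measurable_sum _ fun β' _ => hme β β']
          exact Finset.sum_congr rfl fun β _ => (lintegral_finsetSum _ fun β' _ => hme β β').symm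
      _ ≤ ∑ β₀ : ℤˣ, ∑ β₀' : ℤˣ, ∫⁻ q, 4 ^ N * (K * ∑ j ∈ Finset.range N, ρ ^ j +
            ρ ^ N * {q | |chainStep (q, β₀) x - chainStep (q, β₀') y| ≤ δ}.indicator 1 q)
            ∂quadLaw a b γ := by
          refine Finset.sum_le_sum fun β₀ _ => Finset.sum_le_sum fun β₀' _ =>
            lintegral_mono fun q => ih _ _
      _ = ∑ β₀ : ℤˣ, ∑ β₀' : ℤˣ, 4 ^ N * (K * ∑ j ∈ Finset.range N, ρ ^ j +
            ρ ^ N * quadLaw a b γ {q | |chainStep (q, β₀) x - chainStep (q, β₀') y| ≤ δ}) := by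
          refine Finset.sum_congr rfl fun β₀ _ => Finset.sum_congr rfl fun β₀' _ => ?_
          have hset : MeasurableSet {q : Quad |
              |chainStep (q, β₀) x - chainStep (q, β₀') y| ≤ δ} :=
            measurableSet_le (Measurable.comp continuous_abs.measurable
              ((hm₀ β₀ x).sub (hm₀ β₀' y))) measurable_const
          rw [lintegral_const_mul' _ _ (by simp), lintegral_add_left measurable_const,
            lintegral_const_mul' _ _ (ENNReal.pow_ne_top ENNReal.ofReal_ne_top),
            lintegral_indicator_one hset, lintegral_const, measure_univ, mul_one]
      _ = 4 ^ N * (4 * (K * ∑ j ∈ Finset.range N, ρ ^ j) +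
            ρ ^ N * ∑ β₀ : ℤˣ, ∑ β₀' : ℤˣ,
              quadLaw a b γ {q | |chainStep (q, β₀) x - chainStep (q, β₀') y| ≤ δ}) := by
          simp only [← Finset.mul_sum, Finset.sum_add_distrib]
          simp
          ring
      _ ≤ 4 ^ N * (4 * (K * ∑ j ∈ Finset.range N, ρ ^ j) + ρ ^ N * (4 * (K + ρ *
            {p : ℝ × ℝ | |p.1 - p.2| ≤ δ}.indicator 1 (x, y)))) := by
          gcongr
          exact sum_quadLaw_chainStep_le hγ x y δ
      _ = _ := by
          rw [Finset.sum_range_succ]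
          ring

end Collision

/-! ### Steering the sum of the fixed contributions -/

section Steering

/-- A weak law of large numbers, by Chebyshev's inequality. -/
lemma eventually_pi_deviation_le {α : Type*} [MeasurableSpace α] (μ : Measure α)
    [IsProbabilityMeasure μ] {f : α → ℝ} (hf : Measurable f) {K : ℝ} (hK : ∀ᵐ x ∂μ, |f x| ≤ K)
    {η θ : ℝ} (hη : 0 < η) (hθ : 0 < θ) :
    ∀ᶠ N : ℕ in atTop, (Measure.pi fun _ : Fin N => μ)
      {c | η * N ≤ |∑ i, f (c i) - N * ∫ x, f x ∂μ|} ≤ ENNReal.ofReal θ := by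
  have hLp : MemLp f 2 μ := MemLp.of_bound hf.aestronglyMeasurable K hK
  filter_upwards [eventually_gt_atTop 0,
    (tendsto_natCast_atTop_atTop (R := ℝ)).eventually_ge_atTop (Var[f; μ] / (η ^ 2 * θ))]
    with N hN hN'
  have hN0 : (0 : ℝ) < N := by exact_mod_cast hN
  have hLp' : ∀ i : Fin N, MemLp (fun c : Fin N → α => f (c i)) 2 (Measure.pi fun _ => μ) :=
    fun i => hLp.comp_measurePreserving (measurePreserving_eval (fun _ : Fin N => μ) i)
  have hsum : (∑ i : Fin N, fun c : Fin N → α => f (c i)) = fun c => ∑ i, f (c i) := by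
    ext c; simp
  have hX : MemLp (fun c : Fin N → α => ∑ i, f (c i)) 2 (Measure.pi fun _ => μ) :=
    memLp_finsetSum _ fun i _ => hLp' i
  have hmean : ∫ c : Fin N → α, ∑ i, f (c i) ∂(Measure.pi fun _ => μ) = N * ∫ x, f x ∂μ := by
    rw [integral_finsetSum _ fun i _ => (hLp' i).integrable one_le_two]
    have : ∀ i : Fin N, ∫ c : Fin N → α, f (c i) ∂(Measure.pi fun _ => μ) = ∫ x, f x ∂μ :=
      fun i => integral_comp_eval (μ := fun _ : Fin N => μ) hf.aestronglyMeasurable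
    simp [this]
  have hvar : Var[fun c : Fin N → α => ∑ i, f (c i); Measure.pi fun _ => μ] =
      N * Var[f; μ] := by
    rw [← hsum, variance_sum_pi fun _ => hLp]
    simp
  have h := meas_ge_le_variance_div_sq hX (c := η * N) (by positivity)
  rw [hmean, hvar] at h
  refine h.trans (ENNReal.ofReal_le_ofReal ?_)
  rw [div_le_iff₀ (by positivity)] at hN' ⊢
  nlinarith

/-- The fixed contributions have mean zero since the initial sides are symmetric. -/
lemma integral_fixedPart (a b : ℝ) (γ : Measure Bool) [IsProbabilityMeasure γ] :
    ∫ q, q.fixedPart ∂quadLaw a b γ = 0 := by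
  have hneg : MeasurePreserving (fun u : ℤˣ => -u) coin coin := by
    refine ⟨measurable_of_finite _, Measure.ext_of_singleton fun u => ?_⟩
    rw [Measure.map_apply (measurable_of_finite _) (measurableSet_singleton u)]
    have : (fun u : ℤˣ => -u) ⁻¹' {u} = {-u} := by ext; simp
    rw [this, coin_singleton, coin_singleton]
  have hT := measurePreserving_pi (fun _ : Fin 4 => midLaw a b γ) (fun _ => midLaw a b γ)
    fun _ => (MeasurePreserving.id (unif a b)).prod (hneg.prod (MeasurePreserving.id γ))
  have h1 : ∫ q, q.fixedPart ∂quadLaw a b γ = ∫ q, -q.fixedPart ∂quadLaw a b γ := by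
    conv_lhs => rw [quadLaw, ← hT.map_eq]
    rw [integral_map hT.aemeasurable Quad.measurable_fixedPart.aestronglyMeasurable]
    refine integral_congr_ae (Eventually.of_forall fun q => ?_)
    by_cases hq : Quad.Free q
    · have hq' : Quad.Free (fun i => Prod.map id (Prod.map (fun u => -u) id) (q i)) := hq
      simp only [Quad.fixedPart, if_pos hq, if_pos hq', neg_zero]
    · have hq' : ¬ Quad.Free (fun i => Prod.map id (Prod.map (fun u => -u) id) (q i)) := hq
      simp only [Quad.fixedPart, if_neg hq, if_neg hq']
      simp
  rw [integral_neg] at h1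
  linarith

variable {a b : ℝ} {γ : Measure Bool} [h : Fact (a < b)]

lemma midLaw_Ioo_true_ge [SFinite γ] (hγ : ENNReal.ofReal (1 / 64) ≤ γ {true}) {c d : ℝ}
    (hc : a ≤ c) (hd : d ≤ b) : ENNReal.ofReal (1 / 64 * ((d - c) / (b - a))) ≤
      midLaw a b γ (Set.Ioo c d ×ˢ (Set.univ ×ˢ {true})) := by
  rw [Measure.prod_prod, Measure.prod_prod, measure_univ, one_mul, unif_Ioo h.out hc hd,
    ENNReal.ofReal_mul (by norm_num), mul_comm]
  gcongr

variable [IsProbabilityMeasure γ]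

lemma ae_weightsIn (ι : Type*) [Fintype ι] :
    ∀ᵐ z ∂(Measure.pi fun _ : ι => midLaw a b γ), WeightsIn a b z := by
  refine ae_all_iff.2 fun i => ?_
  have h1 : ∀ᵐ w ∂unif a b, w ∈ Set.Icc a b := ae_cond_mem measurableSet_Icc
  have h2 : ∀ᵐ d ∂midLaw a b γ, d.1 ∈ Set.Icc a b := Measure.quasiMeasurePreserving_fst.ae h1
  exact (measurePreserving_eval (fun _ : ι => midLaw a b γ) i).quasiMeasurePreserving.ae h2

lemma ae_forall_weightsIn (N : ℕ) :
    ∀ᵐ c ∂(Measure.pi fun _ : Fin N => quadLaw a b γ), ∀ i, WeightsIn a b (c i) :=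
  ae_all_iff.2 fun _ => Measure.tendsto_eval_ae_ae.eventually (ae_weightsIn (Fin 4))

lemma integral_steerLength_pos (hγ : ENNReal.ofReal (1 / 64) ≤ γ {true}) :
    0 < ∫ q, q.steerLength ∂quadLaw a b γ := by
  have hab := h.out
  have hint : Integrable Quad.steerLength (quadLaw a b γ) := by
    refine Integrable.of_bound Quad.measurable_steerLength.aestronglyMeasurable (2 * (b - a)) ?_
    filter_upwards [ae_weightsIn (Fin 4)] with q hq
    rw [Real.norm_of_nonneg q.steerLength_nonneg]
    exact Quad.steerLength_le hab.le hq
  rw [integral_pos_iff_support_of_nonneg (fun q => q.steerLength_nonneg) hint]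
  -- The first weight lies in the upper half of `[a, b]` and the second one in the lower half.
  let s : Fin 4 → Set MidData := fun i =>
    Set.Ioo (if i = 0 then (a + b) / 2 else a) (if i = 0 then b else (a + b) / 2) ×ˢ
      (Set.univ ×ˢ {true})
  have hs : ∀ i, midLaw a b γ (s i) ≠ 0 := fun i => by
    refine ((ENNReal.ofReal_pos.2 ?_).trans_le (midLaw_Ioo_true_ge hγ ?_ ?_)).ne'
    · have : 0 < b - a := sub_pos.2 hab
      refine mul_pos (by norm_num) (div_pos ?_ this)
      split_ifs <;> linarith
    · split_ifs <;> linarith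
    · split_ifs <;> linarith
  refine lt_of_lt_of_le ?_ (measure_mono (s := Set.univ.pi s) fun (q : Quad) hq => ?_)
  · rw [Measure.pi_pi]
    exact pos_iff_ne_zero.2 (Finset.prod_ne_zero_iff.2 fun i _ => hs i)
  · have hfree : q.Free := fun i => (hq i trivial).2.2
    have h0 := (hq 0 trivial).1.1
    have h1 := (hq 1 trivial).1.2
    simp only [if_true, one_ne_zero, if_false] at h0 h1
    rw [Function.mem_support, Quad.steerLength, if_pos hfree]
    have h2 : 0 < q.dist₁ := abs_pos.2 (by linarith)
    have h3 : 0 ≤ q.dist₂ := abs_nonneg _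
    linarith

/-- The sum of the fixed contributions of the quadruples of both families, after steering it with
the free quadruples of the first family. -/
noncomputable def steered {N : ℕ} (o : (Fin N → Quad) × (Fin N → Quad)) : ℝ :=
  foldSteps steerStep o.1 (∑ i, (o.1 i).fixedPart + ∑ i, (o.2 i).fixedPart)

lemma measurable_steered {N : ℕ} :
    Measurable (steered : (Fin N → Quad) × (Fin N → Quad) → ℝ) := by
  have h1 : Measurable fun o : (Fin N → Quad) × (Fin N → Quad) =>
      ∑ i, (o.1 i).fixedPart + ∑ i, (o.2 i).fixedPart :=
    (Finset.measurable_sum _ fun i _ => Quad.measurable_fixedPart.comp (by fun_prop)).add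
      (Finset.measurable_sum _ fun i _ => Quad.measurable_fixedPart.comp (by fun_prop))
  exact (measurable_foldSteps measurable_steerStep).comp (measurable_fst.prodMk h1)

variable (a b γ) in
/-- The law of the quadruples used for steering and for the chain. -/
noncomputable abbrev outerLaw (N : ℕ) : Measure ((Fin N → Quad) × (Fin N → Quad)) :=
  (Measure.pi fun _ => quadLaw a b γ).prod (Measure.pi fun _ => quadLaw a b γ)

variable (a b) in
/-- The fixed contributions are of order `√N` and the steps available for steering add up to a
multiple of `N`, so that steering succeeds. -/
lemma eventually_abs_steered_le (hγ : ENNReal.ofReal (1 / 64) ≤ γ {true}) :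
    ∀ᶠ N : ℕ in atTop,
      ENNReal.ofReal (1 / 2) ≤ outerLaw a b γ N {o | |steered o| ≤ 2 * (b - a)} := by
  set μ := ∫ q, q.steerLength ∂quadLaw a b γ with hμ
  have hμ0 : 0 < μ := integral_steerLength_pos hγ
  have e₁ := eventually_pi_deviation_le (quadLaw a b γ) Quad.measurable_steerLength
    (K := 2 * (b - a)) (by
      filter_upwards [ae_weightsIn (Fin 4)] with q hq
      rw [abs_of_nonneg q.steerLength_nonneg]
      exact Quad.steerLength_le h.out.le hq) (η := μ / 2) (θ := 1 / 6) (by positivity)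
    (by norm_num)
  have e₂ := eventually_pi_deviation_le (quadLaw a b γ) Quad.measurable_fixedPart
    (K := 4 * max |a| |b|) (by
      filter_upwards [ae_weightsIn (Fin 4)] with q hq
      exact Quad.abs_fixedPart_le hq) (η := μ / 4) (θ := 1 / 6) (by positivity)
    (by norm_num)
  filter_upwards [e₁, e₂] with N h₁ h₂
  rw [integral_fixedPart a b γ] at h₂
  simp only [mul_zero, sub_zero] at h₂
  set ν := Measure.pi fun _ : Fin N => quadLaw a b γ with hν
  have hprob : IsProbabilityMeasure ν := by rw [hν]; infer_instance
  set E₁ : Set (Fin N → Quad) :=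
    {c | μ / 2 * N ≤ |∑ i, (c i).steerLength - N * ∫ q, q.steerLength ∂quadLaw a b γ|} with hE₁
  set E₂ : Set (Fin N → Quad) := {c | μ / 4 * N ≤ |∑ i, (c i).fixedPart|} with hE₂
  have hbad : (ν.prod ν) {o | |steered o| ≤ 2 * (b - a)}ᶜ ≤ ENNReal.ofReal (1 / 2) := by
    have hsub : ({o | |steered o| ≤ 2 * (b - a)}ᶜ : Set ((Fin N → Quad) × (Fin N → Quad)))
        ≤ᵐ[ν.prod ν] ((E₁ ∪ E₂) ×ˢ Set.univ ∪ Set.univ ×ˢ E₂ : Set _) := by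
      have hw : ∀ᵐ o ∂ν.prod ν, ∀ i, WeightsIn a b (o.1 i) :=
        Measure.quasiMeasurePreserving_fst.ae (ae_forall_weightsIn N)
      filter_upwards [hw] with o ho hbad
      by_contra hcon
      refine hbad ?_
      have hcon' : ¬ ((o.1 ∈ E₁ ∨ o.1 ∈ E₂) ∨ o.2 ∈ E₂) := fun hh => hcon (by
        rcases hh with hh | hh
        · exact Or.inl ⟨hh, trivial⟩
        · exact Or.inr ⟨trivial, hh⟩)
      simp only [not_or, hE₁, hE₂, Set.mem_ofPred_eq, not_le] at hcon'
      obtain ⟨⟨c1, c2⟩, c3⟩ := hcon'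
      refine abs_foldSteps_steerStep_le (fun i => Quad.steerLength_le h.out.le (ho i)) ?_
      have c1' := (abs_lt.1 c1).1
      rw [← hμ] at c1'
      have : 0 < b - a := sub_pos.2 h.out
      have := abs_add_le (∑ i, (o.1 i).fixedPart) (∑ i, (o.2 i).fixedPart)
      linarith
    refine (measure_mono_ae hsub).trans ?_
    refine (measure_union_le _ _).trans ?_
    rw [Measure.prod_prod, Measure.prod_prod, measure_univ, mul_one, one_mul]
    calc ν (E₁ ∪ E₂) + ν E₂ ≤ (ν E₁ + ν E₂) + ν E₂ := by
          gcongr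
          exact measure_union_le _ _
      _ ≤ (ENNReal.ofReal (1 / 6) + ENNReal.ofReal (1 / 6)) + ENNReal.ofReal (1 / 6) := by gcongr
      _ = ENNReal.ofReal (1 / 2) := by
          rw [← ENNReal.ofReal_add (by norm_num) (by norm_num),
            ← ENNReal.ofReal_add (by norm_num) (by norm_num)]
          norm_num
  have hm : MeasurableSet {o : (Fin N → Quad) × (Fin N → Quad) | |steered o| ≤ 2 * (b - a)} :=
    measurableSet_le (measurable_steered.abs) measurable_const
  have h1 := prob_compl_eq_one_sub (μ := ν.prod ν) hm
  have h2 : (ν.prod ν) {o | |steered o| ≤ 2 * (b - a)} =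
      1 - (ν.prod ν) {o | |steered o| ≤ 2 * (b - a)}ᶜ := by
    rw [← prob_compl_eq_one_sub hm.compl, compl_compl]
  change _ ≤ (ν.prod ν) _
  rw [h2]
  calc ENNReal.ofReal (1 / 2) = 1 - ENNReal.ofReal (1 / 2) := by
        rw [← ENNReal.ofReal_one, ← ENNReal.ofReal_sub _ (by norm_num)]
        norm_num
    _ ≤ _ := by gcongr

end Steering

/-! ### The second moment method -/

/-- The second moment method: a union of sets that overlap little has large measure, by the
Cauchy–Schwarz inequality for the number of sets that contain a point and the indicator of the
union. -/
lemma sq_sum_measure_le {α ι : Type*} [MeasurableSpace α] [Fintype ι] (μ : Measure α)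
    {H : ι → Set α} (hH : ∀ i, MeasurableSet (H i)) :
    (∑ i, μ (H i)) ^ 2 ≤ (∑ i, ∑ j, μ (H i ∩ H j)) * μ (⋃ i, H i) := by
  set Z : α → ENNReal := fun x => ∑ i, (H i).indicator 1 x with hZ
  set V : α → ENNReal := (⋃ i, H i).indicator 1 with hV
  have hU : MeasurableSet (⋃ i, H i) := MeasurableSet.iUnion hH
  have hZm : Measurable Z :=
    Finset.measurable_sum _ fun i _ => measurable_one.indicator (hH i)
  have hVm : Measurable V := measurable_one.indicator hU
  have h1 : ∑ i, μ (H i) = ∫⁻ x, (Z * V) x ∂μ := by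
    rw [← Finset.sum_congr rfl fun i _ => lintegral_indicator_one (hH i),
      ← lintegral_finsetSum _ fun i _ => measurable_one.indicator (hH i)]
    refine lintegral_congr fun x => ?_
    simp only [Pi.mul_apply, hZ, hV, Finset.sum_mul]
    refine Finset.sum_congr rfl fun i _ => ?_
    by_cases hx : x ∈ H i
    · have : x ∈ ⋃ i, H i := Set.mem_iUnion.2 ⟨i, hx⟩
      simp [Set.indicator_of_mem this]
    · simp [hx]
  have h2 : ∑ i, ∑ j, μ (H i ∩ H j) = ∫⁻ x, Z x ^ (2 : ℝ) ∂μ := by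
    have : ∀ x, Z x ^ (2 : ℝ) = ∑ i, ∑ j, (H i ∩ H j).indicator 1 x := fun x => by
      rw [ENNReal.rpow_two, sq, hZ, Finset.sum_mul_sum]
      refine Finset.sum_congr rfl fun i _ => Finset.sum_congr rfl fun j _ => ?_
      by_cases hi : x ∈ H i <;> by_cases hj : x ∈ H j <;> simp [hi, hj]
    simp only [this]
    have hm : ∀ i j, Measurable ((H i ∩ H j).indicator (1 : α → ENNReal)) := fun i j =>
      measurable_one.indicator ((hH i).inter (hH j))
    rw [lintegral_finsetSum _ fun i _ => Finset.measurable_sum _ fun j _ => hm i j]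
    refine Finset.sum_congr rfl fun i _ => ?_
    rw [lintegral_finsetSum _ fun j _ => hm i j]
    exact Finset.sum_congr rfl fun j _ =>
      (lintegral_indicator_one ((hH i).inter (hH j))).symm
  have h3 : μ (⋃ i, H i) = ∫⁻ x, V x ^ (2 : ℝ) ∂μ := by
    rw [← lintegral_indicator_one hU]
    refine lintegral_congr fun x => ?_
    by_cases hx : x ∈ ⋃ i, H i
    · simp only [hV, Set.indicator_of_mem hx]; simp
    · simp only [hV, Set.indicator_of_notMem hx]; simp
  rw [h1, h2, h3]
  have h4 := ENNReal.lintegral_mul_le_Lp_mul_Lq μ Real.HolderConjugate.two_two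
    hZm.aemeasurable hVm.aemeasurable
  calc (∫⁻ x, (Z * V) x ∂μ) ^ 2
      ≤ ((∫⁻ x, Z x ^ (2 : ℝ) ∂μ) ^ (1 / (2 : ℝ)) *
          (∫⁻ x, V x ^ (2 : ℝ) ∂μ) ^ (1 / (2 : ℝ))) ^ 2 := by
        gcongr
    _ = _ := by
        rw [mul_pow, ← ENNReal.rpow_two, ← ENNReal.rpow_two, ← ENNReal.rpow_mul,
          ← ENNReal.rpow_mul]
        norm_num

/-! ### Hitting a short interval -/

section Final

variable {a b : ℝ} {γ : Measure Bool} [IsProbabilityMeasure γ] [h : Fact (a < b)]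

/-- The data of the sixteen middle vertices whose weights spread the gain of the center evenly. -/
abbrev FinalData := MidData × (Fin 15 → MidData)

/-- All sixteen middle vertices are free. -/
def FinalData.Free (f : FinalData) : Prop := f.1.2.2 = true ∧ ∀ i, (f.2 i).2.2 = true

/-- The signs of the first fifteen weights. Together with the sign `1` of the last weight they sum
to `0`. -/
def finalSign (i : Fin 15) : ℤˣ := if Even i.1 then -1 else 1

/-- The contribution of the sixteen middle vertices. -/
def FinalData.total (f : FinalData) : ℝ := ∑ i, ((finalSign i : ℤ) : ℝ) * (f.2 i).1 + f.1.1

variable (a b γ) in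
/-- The law of the data of the sixteen middle vertices. -/
noncomputable abbrev finalLaw : Measure FinalData :=
  (midLaw a b γ).prod (Measure.pi fun _ => midLaw a b γ)

lemma sum_finalSign : ∑ i, ((finalSign i : ℤ) : ℝ) = -1 := by
  have h1 : ∑ i, (finalSign i : ℤ) = -1 := by decide
  exact_mod_cast h1

lemma FinalData.measurable_total : Measurable FinalData.total := by
  unfold FinalData.total
  fun_prop

lemma FinalData.measurableSet_free : MeasurableSet {f : FinalData | f.Free} := by
  have h1 : MeasurableSet {f : FinalData | f.1.2.2 = true} :=
    (measurableSet_singleton true).preimage (f := fun f : FinalData => f.1.2.2) (by fun_prop)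
  have h2 : ∀ i, MeasurableSet {f : FinalData | (f.2 i).2.2 = true} := fun i =>
    (measurableSet_singleton true).preimage (f := fun f : FinalData => (f.2 i).2.2) (by fun_prop)
  have h3 := MeasurableSet.iInter h2
  rw [← Set.ofPred_forall] at h3
  exact h1.inter h3

lemma finalLaw_total_le (v t : ℝ) :
    finalLaw a b γ {f | v + f.total ∈ Set.Ioc t (2 * t)} ≤ ENNReal.ofReal (t / (b - a)) := by
  have hm : MeasurableSet {f : FinalData | v + f.total ∈ Set.Ioc t (2 * t)} :=
    measurableSet_Ioc.preimage (FinalData.measurable_total.const_add v)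
  rw [Measure.prod_apply_symm hm]
  calc ∫⁻ y, midLaw a b γ ((fun x => (x, y)) ⁻¹' {f : FinalData | v + f.total ∈ Set.Ioc t (2 * t)})
        ∂(Measure.pi fun _ => midLaw a b γ)
      ≤ ∫⁻ _, ENNReal.ofReal (t / (b - a)) ∂(Measure.pi fun _ : Fin 15 => midLaw a b γ) := by
        refine lintegral_mono fun y => ?_
        set u := v + ∑ i, ((finalSign i : ℤ) : ℝ) * (y i).1 with hu
        refine (measure_mono (t := Set.Ioc (t - u) (2 * t - u) ×ˢ Set.univ)
          fun x hx => ⟨?_, trivial⟩).trans ?_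
        · have h1 : t < v + (∑ i, ((finalSign i : ℤ) : ℝ) * (y i).1 + x.1) := hx.1
          have h2 : v + (∑ i, ((finalSign i : ℤ) : ℝ) * (y i).1 + x.1) ≤ 2 * t := hx.2
          exact ⟨by linarith, by linarith⟩
        · rw [Measure.prod_prod, measure_univ, mul_one]
          refine (unif_le h.out _).trans ?_
          rw [Real.volume_Ioc, ← ENNReal.ofReal_mul (by simp [h.out.le])]
          refine ENNReal.ofReal_le_ofReal (le_of_eq ?_)
          ring
    _ = ENNReal.ofReal (t / (b - a)) := by simp

/-- The sixteen weights move any `v` that is not too large into the interval `(t, 2 t]` with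
probability at least a constant times `t`. The first fifteen weights have to lie in short intervals
which ensure that each of them contributes roughly `-v / 15`, up to a term that does not depend
on `v`. -/
lemma le_finalLaw_total (hγ : ENNReal.ofReal (1 / 64) ≤ γ {true}) {v t : ℝ}
    (hv : |v| ≤ 4 * (b - a)) (ht : 0 < t) (ht' : 8 * t ≤ b - a) :
    ENNReal.ofReal (1 / 64 * (1 / 1920) ^ 15 * (t / (b - a))) ≤
      finalLaw a b γ {f | f.Free ∧ v + f.total ∈ Set.Ioc t (2 * t)} := by
  have hab : 0 < b - a := sub_pos.2 h.out
  have hm : MeasurableSet {f : FinalData | f.Free ∧ v + f.total ∈ Set.Ioc t (2 * t)} :=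
    FinalData.measurableSet_free.inter
      (measurableSet_Ioc.preimage (FinalData.measurable_total.const_add v))
  set S : Set FinalData := {f : FinalData | f.Free ∧ v + f.total ∈ Set.Ioc t (2 * t)} with hS
  set mp := (a + b) / 2 with hmp
  set x : Fin 15 → ℝ := fun i => mp - ((finalSign i : ℤ) : ℝ) * (v / 15) with hx
  set s : Fin 15 → Set MidData := fun i =>
    Set.Ioo (x i - (b - a) / 60) (x i + (b - a) / 60) ×ˢ (Set.univ ×ˢ {true}) with hs
  have hxi : ∀ i, |x i - mp| ≤ 4 / 15 * (b - a) := fun i => by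
    simp only [hx, sub_sub_cancel_left, abs_neg, abs_unit_mul]
    rw [abs_div, abs_of_pos (by norm_num : (0 : ℝ) < 15)]
    linarith
  -- `1 / 1920` is `1 / 64` for being free, times the relative length `1 / 30` of the interval.
  have hsle : ENNReal.ofReal ((1 / 1920) ^ 15) ≤
      (Measure.pi fun _ => midLaw a b γ) (Set.univ.pi s) := by
    rw [Measure.pi_pi, ENNReal.ofReal_pow (by norm_num)]
    calc ENNReal.ofReal (1 / 1920) ^ 15 = ∏ _i : Fin 15, ENNReal.ofReal (1 / 1920) := by simp
      _ ≤ ∏ i, midLaw a b γ (s i) := by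
        refine Finset.prod_le_prod' fun i _ => ?_
        have h1 := abs_le.1 (hxi i)
        refine le_trans (ENNReal.ofReal_le_ofReal ?_) (midLaw_Ioo_true_ge hγ ?_ ?_)
        · have : (x i + (b - a) / 60 - (x i - (b - a) / 60)) / (b - a) = 1 / 30 := by
            field_simp
            ring
          rw [this]
          norm_num
        · simp only [hmp] at h1
          linarith
        · simp only [hmp] at h1
          linarith
  rw [Measure.prod_apply_symm hm]
  calc ENNReal.ofReal (1 / 64 * (1 / 1920) ^ 15 * (t / (b - a)))
      = ENNReal.ofReal (1 / 64 * (t / (b - a))) * ENNReal.ofReal ((1 / 1920) ^ 15) := by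
        rw [← ENNReal.ofReal_mul (by positivity)]
        congr 1
        ring
    _ ≤ ENNReal.ofReal (1 / 64 * (t / (b - a))) *
          (Measure.pi fun _ => midLaw a b γ) (Set.univ.pi s) := by gcongr
    _ = ∫⁻ _ in Set.univ.pi s, ENNReal.ofReal (1 / 64 * (t / (b - a)))
          ∂(Measure.pi fun _ => midLaw a b γ) := (setLIntegral_const _ _).symm
    _ ≤ ∫⁻ y in Set.univ.pi s, midLaw a b γ ((fun x => (x, y)) ⁻¹' S)
          ∂(Measure.pi fun _ => midLaw a b γ) := by
        refine setLIntegral_mono (measurable_measure_prodMk_right hm) fun y hy => ?_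
        -- the part of the sum that is fixed by the first fifteen weights
        set r := v + ∑ i, ((finalSign i : ℤ) : ℝ) * ((y i).1 - mp) with hr
        have hr' : |r| ≤ (b - a) / 4 := by
          have h1 : r = ∑ i, ((finalSign i : ℤ) : ℝ) * ((y i).1 - x i) := by
            have h2 : ∀ i, ((finalSign i : ℤ) : ℝ) * ((y i).1 - x i) =
                ((finalSign i : ℤ) : ℝ) * ((y i).1 - mp) + v / 15 := fun i => by
              have h3 : ((finalSign i : ℤ) : ℝ) * ((finalSign i : ℤ) : ℝ) = 1 := by
                rcases Int.units_eq_one_or (finalSign i) with h | h <;> rw [h] <;> norm_num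
              simp only [hx]
              linear_combination (v / 15) * h3
            rw [Finset.sum_congr rfl fun i _ => h2 i, Finset.sum_add_distrib, hr]
            simp
            ring
          rw [h1]
          refine (Finset.abs_sum_le_sum_abs _ _).trans ?_
          refine (Finset.sum_le_card_nsmul _ _ ((b - a) / 60) fun i _ => ?_).trans ?_
          · rw [abs_unit_mul, abs_le]
            have := (hy i trivial).1
            exact ⟨by linarith [this.1], by linarith [this.2]⟩
          · simp
            linarith
        have hr'' := abs_le.1 hr'
        have htot : ∀ l : MidData, v + FinalData.total (l, y) = r - mp + l.1 := fun l => by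
          simp only [FinalData.total, hr, mul_sub, Finset.sum_sub_distrib, ← Finset.sum_mul,
            sum_finalSign]
          ring
        refine le_trans ?_ (measure_mono (s := Set.Ioo (t + mp - r) (2 * t + mp - r) ×ˢ
          (Set.univ ×ˢ {true})) fun l hl => ?_)
        · have h1 := midLaw_Ioo_true_ge (a := a) (b := b) hγ (c := t + mp - r)
            (d := 2 * t + mp - r) (by simp only [hmp]; linarith) (by simp only [hmp]; linarith)
          convert! h1 using 4
          ring
        · refine ⟨⟨hl.2.2, fun i => (hy i trivial).2.2⟩, ?_⟩
          have h1 := hl.1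
          rw [htot]
          exact ⟨by linarith [h1.1], by linarith [h1.2]⟩
    _ ≤ _ := setLIntegral_le_lintegral _ _

end Final

/-! ### A tree has a gain in a short interval with positive probability -/

section Tree

variable {a b : ℝ} {γ : Measure Bool} [IsProbabilityMeasure γ] [h : Fact (a < b)]

/-- A lower bound, independent of the weight distribution, for the probability that a tree has a
reachable gain in a given interval. The numerator is the square of the first moment and the
denominator is the second moment, up to common factors, as provided by `le_measure_chainHit` and
`sum_collision_le`. -/
noncomputable def hitProb : ℝ := (1 / 64 * (1 / 1920) ^ 15 / 2) ^ 2 / (16 * 64 ^ 4 + 1)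

/-- The data for which the chain with directions `β` leads to a gain in `(t, 2 t]`. -/
def chainHit (a b t : ℝ) {N : ℕ} (β : Fin N → ℤˣ) :
    Set (((Fin N → Quad) × (Fin N → Quad)) × FinalData) :=
  {p | |steered p.1| ≤ 2 * (b - a) ∧ p.2.Free ∧
    (chainEnd p.1.2 β 0 + steered p.1) + p.2.total ∈ Set.Ioc t (2 * t)}

lemma measurable_chainEnd_zero {N : ℕ} (β : Fin N → ℤˣ) :
    Measurable fun c : Fin N → Quad => chainEnd c β 0 :=
  (measurable_chainEnd β).comp (measurable_id.prodMk measurable_const)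

lemma measurableSet_chainHit (a b t : ℝ) {N : ℕ} (β : Fin N → ℤˣ) :
    MeasurableSet (chainHit a b t β) := by
  have h1 : Measurable fun p : ((Fin N → Quad) × (Fin N → Quad)) × FinalData => steered p.1 :=
    measurable_steered.comp measurable_fst
  have h2 : Measurable fun p : ((Fin N → Quad) × (Fin N → Quad)) × FinalData =>
      chainEnd p.1.2 β 0 := (measurable_chainEnd_zero β).comp (by fun_prop)
  have h3 : Measurable fun p : ((Fin N → Quad) × (Fin N → Quad)) × FinalData => p.2.total :=
    FinalData.measurable_total.comp measurable_snd
  exact (measurableSet_le h1.abs measurable_const).inter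
    ((FinalData.measurableSet_free.preimage measurable_snd).inter
      (measurableSet_Ioc.preimage ((h2.add h1).add h3)))

lemma le_measure_chainHit (hγ : ENNReal.ofReal (1 / 64) ≤ γ {true}) {t : ℝ} (ht : 0 < t)
    (ht' : 8 * t ≤ b - a) {N : ℕ}
    (hN : ENNReal.ofReal (1 / 2) ≤ outerLaw a b γ N {o | |steered o| ≤ 2 * (b - a)})
    (β : Fin N → ℤˣ) :
    ENNReal.ofReal (1 / 64 * (1 / 1920) ^ 15 / 2 * (t / (b - a))) ≤
      ((outerLaw a b γ N).prod (finalLaw a b γ)) (chainHit a b t β) := by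
  have hab : 0 < b - a := sub_pos.2 h.out
  have hG : MeasurableSet {o : (Fin N → Quad) × (Fin N → Quad) | |steered o| ≤ 2 * (b - a)} :=
    measurableSet_le measurable_steered.abs measurable_const
  have hw : ∀ᵐ o ∂outerLaw a b γ N, ∀ i, WeightsIn a b (o.2 i) :=
    Measure.quasiMeasurePreserving_snd.ae (ae_forall_weightsIn N)
  rw [Measure.prod_apply (measurableSet_chainHit a b t β)]
  calc ENNReal.ofReal (1 / 64 * (1 / 1920) ^ 15 / 2 * (t / (b - a)))
      = ENNReal.ofReal (1 / 64 * (1 / 1920) ^ 15 * (t / (b - a))) * ENNReal.ofReal (1 / 2) := by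
        rw [← ENNReal.ofReal_mul (by positivity)]
        congr 1
        ring
    _ ≤ ENNReal.ofReal (1 / 64 * (1 / 1920) ^ 15 * (t / (b - a))) *
          outerLaw a b γ N {o | |steered o| ≤ 2 * (b - a)} := by gcongr
    _ = ∫⁻ _ in {o | |steered o| ≤ 2 * (b - a)},
          ENNReal.ofReal (1 / 64 * (1 / 1920) ^ 15 * (t / (b - a))) ∂outerLaw a b γ N :=
        (setLIntegral_const _ _).symm
    _ ≤ ∫⁻ o in {o | |steered o| ≤ 2 * (b - a)},
          finalLaw a b γ (Prod.mk o ⁻¹' chainHit a b t β) ∂outerLaw a b γ N := by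
        refine setLIntegral_mono_ae
          (measurable_measure_prodMk_left (measurableSet_chainHit a b t β)).aemeasurable ?_
        filter_upwards [hw] with o ho hs
        have h1 : |chainEnd o.2 β 0| ≤ 2 * (b - a) :=
          abs_foldSteps_chainStep_le (fun i => Quad.dist₁_le (ho i))
            (fun i => Quad.dist₂_le (ho i)) (by simp [hab.le])
        have h2 : |chainEnd o.2 β 0 + steered o| ≤ 4 * (b - a) :=
          (abs_add_le _ _).trans (by linarith [show |steered o| ≤ 2 * (b - a) from hs])
        refine (le_finalLaw_total hγ h2 ht ht').trans (measure_mono fun f hf => ?_)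
        exact ⟨hs, hf⟩
    _ ≤ _ := setLIntegral_le_lintegral _ _

/-- Two choices of directions can succeed together only if their end points are close. -/
lemma measure_chainHit_inter_le {t : ℝ} {N : ℕ} (β β' : Fin N → ℤˣ) :
    ((outerLaw a b γ N).prod (finalLaw a b γ)) (chainHit a b t β ∩ chainHit a b t β') ≤
      ENNReal.ofReal (t / (b - a)) * (Measure.pi fun _ : Fin N => quadLaw a b γ)
        {c | |chainEnd c β 0 - chainEnd c β' 0| ≤ t} := by
  rw [Measure.prod_apply ((measurableSet_chainHit a b t β).inter
    (measurableSet_chainHit a b t β'))]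
  set T : Set (Fin N → Quad) := {c | |chainEnd c β 0 - chainEnd c β' 0| ≤ t} with hT
  have hTm : MeasurableSet T := measurableSet_le
    ((measurable_chainEnd_zero β).sub (measurable_chainEnd_zero β')).abs measurable_const
  calc ∫⁻ o, finalLaw a b γ (Prod.mk o ⁻¹' (chainHit a b t β ∩ chainHit a b t β'))
        ∂outerLaw a b γ N
      ≤ ∫⁻ o, (Set.univ ×ˢ T : Set ((Fin N → Quad) × (Fin N → Quad))).indicator
          (fun _ => ENNReal.ofReal (t / (b - a))) o ∂outerLaw a b γ N := by
        refine lintegral_mono fun o => ?_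
        by_cases ho : o.2 ∈ T
        · rw [Set.indicator_of_mem (show o ∈ Set.univ ×ˢ T from ⟨trivial, ho⟩)]
          exact (measure_mono fun f hf => hf.1.2.2).trans
            (finalLaw_total_le (chainEnd o.2 β 0 + steered o) t)
        · have : Prod.mk o ⁻¹' (chainHit a b t β ∩ chainHit a b t β') = ∅ := by
            refine Set.eq_empty_of_forall_notMem fun f hf => ho ?_
            have h1 := hf.1.2.2
            have h2 := hf.2.2.2
            simp only [Set.mem_Ioc] at h1 h2
            change |chainEnd o.2 β 0 - chainEnd o.2 β' 0| ≤ t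
            rw [abs_le]
            constructor <;> linarith [h1.1, h1.2, h2.1, h2.2]
          simp [this]
    _ = _ := by
        rw [lintegral_indicator_const (MeasurableSet.univ.prod hTm), Measure.prod_prod,
          measure_univ, one_mul]

lemma chainRate_mem : chainRate ∈ Set.Ioo (0 : ℝ) 1 := by
  constructor <;> norm_num [chainRate]

lemma sum_chainRate_pow_le (N : ℕ) :
    ∑ j ∈ Finset.range N, ENNReal.ofReal chainRate ^ j ≤ ENNReal.ofReal (2 * 64 ^ 4) := by
  refine (ENNReal.sum_le_tsum _).trans ?_
  rw [ENNReal.tsum_geometric, ← ENNReal.ofReal_one, ← ENNReal.ofReal_sub _ chainRate_mem.1.le,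
    ← ENNReal.ofReal_inv_of_pos (by linarith [chainRate_mem.2])]
  refine ENNReal.ofReal_le_ofReal ?_
  norm_num [chainRate]

lemma hitProb_le_measure_iUnion (hγ : ENNReal.ofReal (1 / 64) ≤ γ {true}) {t : ℝ} (ht : 0 < t)
    (ht' : 8 * t ≤ b - a) {N : ℕ}
    (hN : ENNReal.ofReal (1 / 2) ≤ outerLaw a b γ N {o | |steered o| ≤ 2 * (b - a)})
    (htN : chainRate ^ N * (b - a) ≤ t) :
    ENNReal.ofReal hitProb ≤ ((outerLaw a b γ N).prod (finalLaw a b γ))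
      (⋃ β : Fin N → ℤˣ, chainHit a b t β) := by
  have hab : 0 < b - a := sub_pos.2 h.out
  set P := (outerLaw a b γ N).prod (finalLaw a b γ) with hP
  set τ := t / (b - a) with hτ
  have hτ0 : 0 < τ := div_pos ht hab
  have h1 := sq_sum_measure_le P fun β : Fin N → ℤˣ => measurableSet_chainHit a b t β
  have hcard : (Finset.univ : Finset (Fin N → ℤˣ)).card = 2 ^ N := by simp
  have hlow : (2 : ENNReal) ^ N * ENNReal.ofReal (1 / 64 * (1 / 1920) ^ 15 / 2 * τ) ≤
      ∑ β : Fin N → ℤˣ, P (chainHit a b t β) := by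
    calc _ = ∑ _β : Fin N → ℤˣ, ENNReal.ofReal (1 / 64 * (1 / 1920) ^ 15 / 2 * τ) := by
          rw [Finset.sum_const, hcard, nsmul_eq_mul]
          push_cast
          rfl
      _ ≤ _ := Finset.sum_le_sum fun β _ => le_measure_chainHit hγ ht ht' hN β
  have hup : ∑ β : Fin N → ℤˣ, ∑ β' : Fin N → ℤˣ, P (chainHit a b t β ∩ chainHit a b t β') ≤
      4 ^ N * ENNReal.ofReal ((16 * 64 ^ 4 + 1) * τ ^ 2) := by
    calc _ ≤ ∑ β : Fin N → ℤˣ, ∑ β' : Fin N → ℤˣ, ENNReal.ofReal τ *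
          (Measure.pi fun _ : Fin N => quadLaw a b γ)
            {c | |chainEnd c β 0 - chainEnd c β' 0| ≤ t} :=
          Finset.sum_le_sum fun β _ => Finset.sum_le_sum fun β' _ => measure_chainHit_inter_le β β'
      _ = ENNReal.ofReal τ * ∑ β : Fin N → ℤˣ, ∑ β' : Fin N → ℤˣ,
          (Measure.pi fun _ : Fin N => quadLaw a b γ)
            {c | |chainEnd c β 0 - chainEnd c β' 0| ≤ t} := by
          simp only [Finset.mul_sum]
      _ ≤ ENNReal.ofReal τ * (4 ^ N * (8 * ENNReal.ofReal τ * ENNReal.ofReal (2 * 64 ^ 4) +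
            ENNReal.ofReal τ * 1)) := by
          gcongr
          refine (sum_collision_le hγ t N 0 0).trans ?_
          gcongr
          · exact sum_chainRate_pow_le N
          · rw [← ENNReal.ofReal_pow chainRate_mem.1.le]
            exact ENNReal.ofReal_le_ofReal ((le_div_iff₀ hab).2 htN)
          · exact Set.indicator_le_self _ _ _
      _ = 4 ^ N * ENNReal.ofReal ((16 * 64 ^ 4 + 1) * τ ^ 2) := by
          rw [show (8 : ENNReal) = ENNReal.ofReal 8 by simp, mul_one,
            ← ENNReal.ofReal_mul (by norm_num), ← ENNReal.ofReal_mul (by positivity),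
            ← ENNReal.ofReal_add (by positivity) (by positivity), mul_left_comm,
            ← ENNReal.ofReal_mul (by positivity)]
          congr 2
          ring
  have h2 : (4 : ENNReal) ^ N * ENNReal.ofReal ((16 * 64 ^ 4 + 1) * τ ^ 2) *
      ENNReal.ofReal hitProb ≤ 4 ^ N * ENNReal.ofReal ((16 * 64 ^ 4 + 1) * τ ^ 2) *
        P (⋃ β : Fin N → ℤˣ, chainHit a b t β) := by
    calc _ = ((2 : ENNReal) ^ N * ENNReal.ofReal (1 / 64 * (1 / 1920) ^ 15 / 2 * τ)) ^ 2 := by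
          rw [mul_pow, ← pow_mul, mul_comm N 2, pow_mul, mul_assoc,
            ← ENNReal.ofReal_mul (by positivity), ← ENNReal.ofReal_pow (by positivity)]
          have : (16 * 64 ^ 4 + 1) * τ ^ 2 * hitProb =
              (1 / 64 * (1 / 1920) ^ 15 / 2 * τ) ^ 2 := by
            rw [hitProb, mul_pow]
            field_simp
          rw [this]
          norm_num
      _ ≤ (∑ β : Fin N → ℤˣ, P (chainHit a b t β)) ^ 2 := by gcongr
      _ ≤ _ := h1
      _ ≤ _ := by gcongr
  refine (ENNReal.mul_le_mul_iff_right ?_ ?_).1 h2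
  · refine mul_ne_zero (by simp) (ENNReal.ofReal_pos.2 (by positivity)).ne'
  · exact ENNReal.mul_ne_top (by simp) ENNReal.ofReal_ne_top

end Tree

/-! ### Splitting the middle vertices of a tree -/

/-- The indices of the middle vertices of a tree: two families of `N` quadruples and sixteen
further middle vertices. -/
abbrev SplitIndex (N : ℕ) := ((Fin N × Fin 4) ⊕ (Fin N × Fin 4)) ⊕ Option (Fin 15)

/-- Some enumeration of the middle vertices. -/
noncomputable def splitEquiv (N : ℕ) : SplitIndex N ≃ Fin (2 * (4 * N + 8)) :=
  Fintype.equivOfCardEq (by simp; ring)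

/-- The data of the middle vertices of a tree, in the form used by the chain. -/
noncomputable def splitData {N : ℕ} (z : Fin (2 * (4 * N + 8)) → MidData) :
    ((Fin N → Quad) × (Fin N → Quad)) × FinalData :=
  ((fun i j => z (splitEquiv N (.inl (.inl (i, j)))),
      fun i j => z (splitEquiv N (.inl (.inr (i, j))))),
    (z (splitEquiv N (.inr none)), fun i => z (splitEquiv N (.inr (some i)))))

lemma exists_isReachable_of_chainHit {a b t : ℝ} {N : ℕ} {β : Fin N → ℤˣ}
    {z : Fin (2 * (4 * N + 8)) → MidData} (hz : splitData z ∈ chainHit a b t β) :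
    ∃ v ∈ Set.Ioc t (2 * t), IsReachable z v := by
  set o := (splitData z).1 with ho
  set f := (splitData z).2 with hf
  refine ⟨_, hz.2.2, IsReachable.of_comp_equiv (splitEquiv N) ?_⟩
  set x := ∑ i, (o.1 i).fixedPart + ∑ i, (o.2 i).fixedPart with hx
  have hA : IsReachable (fun p : Fin N × Fin 4 => o.1 p.1 p.2)
      (∑ i, (o.1 i).fixedPart + (steered o - x)) :=
    isReachable_foldSteps (g := id) isReachable_steerStep o.1 x
  have hC : IsReachable (fun p : Fin N × Fin 4 => o.2 p.1 p.2)
      (∑ i, (o.2 i).fixedPart + (chainEnd o.2 β 0 - 0)) :=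
    isReachable_foldSteps (g := Prod.fst) isReachable_chainStep (fun i => (o.2 i, β i)) 0
  have hF : IsReachable f.2 (∑ i, ((finalSign i : ℤ) : ℝ) * (f.2 i).1) :=
    ⟨finalSign, fun i => Or.inr (hz.2.1.2 i), rfl⟩
  have key := IsReachable.sum (z := z ∘ splitEquiv N) (IsReachable.sum hA hC)
    (IsReachable.option (z := fun o => z (splitEquiv N (.inr o))) hz.2.1.1 hF)
  convert key using 1
  change chainEnd o.2 β 0 + steered o + (∑ i, ((finalSign i : ℤ) : ℝ) * (f.2 i).1 + f.1.1) =
    _ + (_ + f.1.1)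
  rw [hx]
  ring

lemma measurableSet_hit {ι : Type*} [Fintype ι] (s : Set ℝ) (hs : MeasurableSet s) :
    MeasurableSet {z : ι → MidData | ∃ v ∈ s, IsReachable z v} := by
  have : {z : ι → MidData | ∃ v ∈ s, IsReachable z v} =
      ⋃ ε : ι → ℤˣ, {z |
        (∀ i, (ε i, (z i).2) ∈ {p : ℤˣ × ℤˣ × Bool | p.1 = p.2.1 ∨ p.2.2 = true}) ∧
        ∑ i, ((ε i : ℤ) : ℝ) * (z i).1 ∈ s} := by
    ext z
    simp only [IsReachable, Set.mem_iUnion]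
    constructor
    · rintro ⟨_, hv, ε, hε, rfl⟩
      exact ⟨ε, hε, hv⟩
    · rintro ⟨ε, hε, hv⟩
      exact ⟨_, hv, ε, hε, rfl⟩
  rw [this]
  refine MeasurableSet.iUnion fun ε => MeasurableSet.inter ?_ ?_
  · have h1 : ∀ i, MeasurableSet {z : ι → MidData |
        (ε i, (z i).2) ∈ {p : ℤˣ × ℤˣ × Bool | p.1 = p.2.1 ∨ p.2.2 = true}} := fun i =>
      (Set.toFinite _).measurableSet.preimage
        (f := fun z : ι → MidData => ((ε i, (z i).2) : ℤˣ × ℤˣ × Bool)) (by fun_prop)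
    have h2 := MeasurableSet.iInter h1
    rwa [← Set.ofPred_forall] at h2
  · exact hs.preimage (by fun_prop)

section Tree

variable {a b : ℝ} {γ : Measure Bool} [IsProbabilityMeasure γ] [h : Fact (a < b)]

variable (a b γ) in
lemma measurePreserving_splitData (N : ℕ) :
    MeasurePreserving (splitData (N := N)) (Measure.pi fun _ => midLaw a b γ)
      ((outerLaw a b γ N).prod (finalLaw a b γ)) := by
  have h₁ := measurePreserving_comp_equiv (midLaw a b γ) (splitEquiv N)
  have h₂ := (measurePreserving_sumPiEquivProdPi
    (fun _ : SplitIndex N => midLaw a b γ)).comp h₁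
  have h₃ := ((measurePreserving_sumPiEquivProdPi
    (fun _ : (Fin N × Fin 4) ⊕ (Fin N × Fin 4) => midLaw a b γ)).prod
      (measurePreserving_option (ι := Fin 15) (midLaw a b γ))).comp h₂
  exact (((measurePreserving_curry (midLaw a b γ)).prod
    (measurePreserving_curry (midLaw a b γ))).prod (MeasurePreserving.id _)).comp h₃

variable (a b) in
/-- Every interval `(t, 2 t]` that is not too short contains a reachable gain with a probability
that is bounded below by a constant. -/
lemma eventually_hitProb_le (hγ : ENNReal.ofReal (1 / 64) ≤ γ {true}) :
    ∀ᶠ N : ℕ in atTop, ∀ t : ℝ, 0 < t → 8 * t ≤ b - a → chainRate ^ N * (b - a) ≤ t →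
      ENNReal.ofReal hitProb ≤ (Measure.pi fun _ : Fin (2 * (4 * N + 8)) => midLaw a b γ)
        {z | ∃ v ∈ Set.Ioc t (2 * t), IsReachable z v} := by
  filter_upwards [eventually_abs_steered_le a b hγ] with N hN t ht ht' htN
  refine (hitProb_le_measure_iUnion hγ ht ht' hN htN).trans ?_
  rw [← (measurePreserving_splitData a b γ N).measure_preimage
    (MeasurableSet.iUnion fun β => measurableSet_chainHit a b t β).nullMeasurableSet]
  refine measure_mono fun z hz => ?_
  obtain ⟨β, hβ⟩ := Set.mem_iUnion.1 hz
  exact exists_isReachable_of_chainHit hβ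

end Tree

/-! ### Long executions from reachable gains -/

open Classical in
/-- If every level is served by at least `2 * (M + 1)` trees, then each of the `M + 1` levels can
be given two trees of its own, by Hall's theorem. -/
lemma exists_injective_of_le_card {T : Type*} [Fintype T] {M : ℕ} (P : ℕ → T → Prop)
    (h : ∀ i ≤ M, 2 * (M + 1) ≤ (Finset.univ.filter (P i)).card) :
    ∃ u : Fin (M + 1) × Fin 2 → T, Function.Injective u ∧ ∀ p, P p.1 (u p) := by
  obtain ⟨u, hu, hu'⟩ := (Finset.all_card_le_biUnion_card_iff_exists_injective
    fun p : Fin (M + 1) × Fin 2 => Finset.univ.filter (P p.1)).1 fun s => by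
      obtain rfl | ⟨p, hp⟩ := s.eq_empty_or_nonempty
      · simp
      calc s.card ≤ 2 * (M + 1) := by simpa [mul_comm] using s.card_le_univ
        _ ≤ _ := h p.1 (Nat.lt_succ_iff.1 p.1.2)
        _ ≤ _ := Finset.card_le_card
          (Finset.subset_biUnion_of_mem
            (fun p : Fin (M + 1) × Fin 2 => Finset.univ.filter (P p.1)) hp)
  exact ⟨u, hu, fun p => (Finset.mem_filter.1 (hu' p)).2⟩

/-- The gains that a tree has to offer at level `i` lie in `(t, 2 t]` with `t = levelBase D M i`.
These intervals are so far apart that two gains of one level add up to less than any gain of the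
next level, and the top level stays below `D / 8`. -/
noncomputable def levelBase (D : ℝ) (M i : ℕ) : ℝ := D * 4 ^ i / 4 ^ (M + 2)

lemma levelBase_pos {D : ℝ} (hD : 0 < D) (M i : ℕ) : 0 < levelBase D M i := by
  unfold levelBase; positivity

lemma levelBase_succ (D : ℝ) (M i : ℕ) : levelBase D M (i + 1) = 4 * levelBase D M i := by
  unfold levelBase; ring

lemma levelBase_le {D : ℝ} (hD : 0 < D) {M i : ℕ} (hi : i ≤ M) : 8 * levelBase D M i ≤ D := by
  have h : (4 : ℝ) ^ i ≤ 4 ^ M := pow_le_pow_right₀ (by norm_num) hi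
  rw [levelBase, mul_div_assoc', div_le_iff₀ (by positivity), pow_add]
  nlinarith [mul_le_mul_of_nonneg_left h hD.le, mul_pos hD (pow_pos (by norm_num : (0 : ℝ) < 4) M)]

lemma div_le_levelBase {D : ℝ} (hD : 0 < D) (M i : ℕ) : D / 4 ^ (M + 2) ≤ levelBase D M i := by
  unfold levelBase
  gcongr
  exact le_mul_of_one_le_right hD.le (one_le_pow₀ (by norm_num))

/-- The data of one tree allow a gain of level `i`. -/
def HitsLevel {ι : Type*} [Fintype ι] (D : ℝ) (M i : ℕ) (z : ι → MidData) : Prop :=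
  ∃ v ∈ Set.Ioc (levelBase D M i) (2 * levelBase D M i), IsReachable z v

lemma isFreeMid_of_freeFlag {k m : ℕ} {B : ℝ} {X : (depthTwoForest k m).edgeSet → ℝ}
    {σ : Cut (ForestVertex k m)} {q : (Fin k × Fin 2) × Fin (2 * m)}
    (hX : |X (edgeEquiv k m (q, none))| ≤ B)
    (h : freeFlag B (fun j => X (edgeEquiv k m (q, some j)))
      (fun j => relSide σ (q, some j)) = true) : IsFreeMid X σ q := by
  simp only [freeFlag, decide_eq_true_eq] at h
  rw [IsFreeMid, Fin.sum_univ_two]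
  linarith [h 0, h 1]

open Classical in
lemma exists_long_execution_of_hitsLevel {k m M : ℕ} [Fintype (depthTwoForest k m).edgeSet]
    {a b D : ℝ} (hD : 0 < D)
    (p : ((depthTwoForest k m).edgeSet → ℝ) × Cut (ForestVertex k m))
    (hw : ∀ τ, WeightsIn a b (forestData a b p τ))
    (h : ∀ i ≤ M, 2 * (M + 1) ≤
      (Finset.univ.filter fun τ => HitsLevel D M i (forestData a b p τ)).card) :
    ∃ L, IsFlipExecution (depthTwoForest k m) p.1 3 p.2 L ∧ 2 ^ M ≤ L.length := by
  obtain ⟨u, hu, hhit⟩ := exists_injective_of_le_card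
    (fun i τ => HitsLevel D M i (forestData a b p τ)) h
  choose v hv ε hε hεv using hhit
  have hlt : ∀ i ≤ M, i < M + 1 := fun i hi => Nat.lt_succ_of_le hi
  have hval : ∀ i ≤ M, ((Fin.ofNat (M + 1) i : Fin (M + 1)) : ℕ) = i := fun i hi =>
    Nat.mod_eq_of_lt (hlt i hi)
  refine exists_long_execution p.1 p.2
    (ε := fun q => Function.extend u ε (fun τ s => relSide p.2 ((τ, s), none)) q.1 q.2)
    (u := fun i j => u (Fin.ofNat (M + 1) i, j)) (g := fun i j => v (Fin.ofNat (M + 1) i, j))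
    ?_ ?_ ?_ ?_ ?_
  · rintro ⟨τ, s⟩
    by_cases hτ : ∃ x, u x = τ
    · obtain ⟨x, rfl⟩ := hτ
      simp only [hu.extend_apply]
      exact (hε x s).imp id fun h =>
        isFreeMid_of_freeFlag (abs_le_max_abs_abs (hw (u x) s).1 (hw (u x) s).2) h
    · simp only [Function.extend_apply' _ _ _ hτ]
      exact Or.inl trivial
  · intro i hi i' hi' j j' hij
    have := Prod.ext_iff.1 (hu hij)
    refine ⟨?_, this.2⟩
    have h' := congrArg Fin.val this.1
    rwa [hval i hi, hval i' hi'] at h'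
  · intro i hi j
    simp only [hu.extend_apply]
    exact (hεv _).symm
  · exact fun j => (levelBase_pos hD _ _).trans (hv _).1
  · intro i hi j
    have h₀ := (hv (Fin.ofNat (M + 1) i, 0)).2
    have h₁ := (hv (Fin.ofNat (M + 1) i, 1)).2
    have h₂ := (hv (Fin.ofNat (M + 1) (i + 1), j)).1
    simp only [hval i hi.le] at h₀ h₁
    simp only [hval (i + 1) hi, levelBase_succ] at h₂
    linarith

/-! ### Many trees serve every level -/

open Classical in
/-- A Chernoff bound: among independent trials that succeed with probability at least `p`, few
succeed only with exponentially small probability. -/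
lemma measure_card_lt_le {α T : Type*} [MeasurableSpace α] [Fintype T] (μ : Measure α)
    [IsProbabilityMeasure μ] {H : Set α} (hH : MeasurableSet H) {p : ℝ}
    (hp : ENNReal.ofReal p ≤ μ H) (r : ℕ) :
    (Measure.pi fun _ : T => μ) {ω | (Finset.univ.filter fun τ => ω τ ∈ H).card < r} ≤
      2 ^ r * ENNReal.ofReal (1 - p / 2) ^ Fintype.card T := by
  set P := Measure.pi fun _ : T => μ
  -- Markov's inequality is applied to the product of the `f (ω τ)`, which is `2⁻¹` to the number
  -- of successes.
  set f : α → ENNReal := H.indicator (fun _ => 2⁻¹) + Hᶜ.indicator (fun _ => 1) with hf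
  have hfm : Measurable f :=
    (measurable_const.indicator hH).add (measurable_const.indicator hH.compl)
  have hfH : ∀ x ∈ H, f x = 2⁻¹ := fun x hx => by simp [hf, hx]
  have hfH' : ∀ x ∉ H, f x = 1 := fun x hx => by simp [hf, hx]
  have hint : ∫⁻ x, f x ∂μ ≤ ENNReal.ofReal (1 - p / 2) := by
    have h1 : ∫⁻ x, f x ∂μ = 2⁻¹ * μ H + μ Hᶜ := by
      simp only [hf, Pi.add_apply]
      rw [lintegral_add_left (measurable_const.indicator hH), lintegral_indicator hH,
        lintegral_indicator hH.compl]
      simp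
    have h2 : p ≤ μ.real H := (ENNReal.ofReal_le_iff_le_toReal (measure_ne_top _ _)).1 hp
    have h3 : μ.real Hᶜ = 1 - μ.real H := probReal_compl_eq_one_sub hH
    rw [h1, ← ofReal_measureReal, ← ofReal_measureReal, h3,
      show (2⁻¹ : ENNReal) = ENNReal.ofReal 2⁻¹ by
        rw [ENNReal.ofReal_inv_of_pos two_pos, ENNReal.ofReal_ofNat],
      ← ENNReal.ofReal_mul (by norm_num), ← ENNReal.ofReal_add (by positivity) (by
        rw [← h3]; positivity)]
    exact ENNReal.ofReal_le_ofReal (by linarith)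
  have hprod : ∫⁻ ω, ∏ τ, f (ω τ) ∂P = (∫⁻ x, f x ∂μ) ^ Fintype.card T := by
    rw [lintegral_prod_eq_prod_lintegral_of_indepFun Finset.univ (fun τ (ω : T → α) => f (ω τ))
      (iIndepFun_pi fun _ => hfm.aemeasurable) fun τ => hfm.comp (measurable_pi_apply τ)]
    rw [Finset.prod_congr rfl fun τ _ =>
      (measurePreserving_eval (fun _ : T => μ) τ).lintegral_comp hfm]
    simp
  have hval : ∀ ω : T → α, ∏ τ, f (ω τ) = 2⁻¹ ^ (Finset.univ.filter fun τ => ω τ ∈ H).card :=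
    fun ω => by
      rw [← Finset.prod_filter_mul_prod_filter_not Finset.univ fun τ => ω τ ∈ H,
        Finset.prod_congr rfl fun τ hτ => hfH _ (Finset.mem_filter.1 hτ).2,
        Finset.prod_congr rfl fun τ hτ => hfH' _ (Finset.mem_filter.1 hτ).2]
      simp
  calc P {ω | (Finset.univ.filter fun τ => ω τ ∈ H).card < r}
      ≤ P {ω | 1 ≤ 2 ^ r * ∏ τ, f (ω τ)} := by
        refine measure_mono fun ω hω => ?_
        rw [Set.mem_ofPred_eq, hval]
        calc (1 : ENNReal) = 2 ^ r * 2⁻¹ ^ r := by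
              rw [← mul_pow, ENNReal.mul_inv_cancel (by simp) (by simp), one_pow]
          _ ≤ _ := mul_le_mul_right (pow_le_pow_right_of_le_one' (by simp) (le_of_lt hω)) _
    _ ≤ ∫⁻ ω, 2 ^ r * ∏ τ, f (ω τ) ∂P := by
        have := mul_meas_ge_le_lintegral (μ := P) (f := fun ω => 2 ^ r * ∏ τ, f (ω τ))
          (measurable_const.mul (Finset.measurable_fun_prod _ fun τ _ =>
            hfm.comp (measurable_pi_apply τ))) 1
        simpa using this
    _ = 2 ^ r * (∫⁻ x, f x ∂μ) ^ Fintype.card T := by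
        rw [lintegral_const_mul' _ _ (by simp), hprod]
    _ ≤ _ := by gcongr

/-- The ratio of the number of levels to `k`. The first bound makes the Chernoff bound beat the
number of trees that are needed, the second one keeps the lowest level above the precision
`chainRate ^ k` that a tree reaches. -/
noncomputable def levelRate : ℝ := min (hitProb / 8) ((1 / 64) ^ 4 / 8)

lemma hitProb_pos : 0 < hitProb := by unfold hitProb; positivity

lemma hitProb_le_one : hitProb ≤ 1 := by norm_num [hitProb]

lemma levelRate_pos : 0 < levelRate := lt_min (by linarith [hitProb_pos]) (by norm_num)

lemma four_pow_le_exp (n : ℕ) : (4 : ℝ) ^ n ≤ Real.exp (2 * n) := by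
  have h : (2 : ℝ) ≤ Real.exp 1 := by linarith [Real.add_one_le_exp 1]
  calc (4 : ℝ) ^ n = 2 ^ (2 * n) := by rw [pow_mul]; norm_num
    _ ≤ Real.exp 1 ^ (2 * n) := by gcongr
    _ = _ := by rw [← Real.exp_nat_mul]; push_cast; ring_nf

lemma eventually_chainRate_pow_le {D : ℝ} (hD : 0 < D) :
    ∀ᶠ k : ℕ in atTop, chainRate ^ k * D ≤ D / 4 ^ (⌊levelRate * k⌋₊ + 2) := by
  have hk : Tendsto (fun k : ℕ => (1 / 64 : ℝ) ^ 4 / 4 * k) atTop atTop :=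
    tendsto_natCast_atTop_atTop.const_mul_atTop (by norm_num)
  filter_upwards [hk.eventually_ge_atTop 4] with k hk
  have hM : (⌊levelRate * k⌋₊ : ℝ) ≤ (1 / 64) ^ 4 / 8 * k :=
    (Nat.floor_le (mul_nonneg levelRate_pos.le k.cast_nonneg)).trans
      (mul_le_mul_of_nonneg_right (min_le_right _ _) k.cast_nonneg)
  have h1 : chainRate ^ k ≤ Real.exp (-((1 / 64) ^ 4 / 2 * k)) := by
    have : chainRate ≤ Real.exp (-((1 / 64) ^ 4 / 2)) := by
      have := Real.add_one_le_exp (-((1 / 64) ^ 4 / 2))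
      unfold chainRate
      linarith
    calc chainRate ^ k ≤ _ := pow_le_pow_left₀ chainRate_mem.1.le this k
      _ = _ := by rw [← Real.exp_nat_mul]; ring_nf
  rw [le_div_iff₀ (by positivity)]
  have h2 : chainRate ^ k * 4 ^ (⌊levelRate * k⌋₊ + 2) ≤ 1 := by
    calc _ ≤ Real.exp (-((1 / 64) ^ 4 / 2 * k)) * Real.exp (2 * (⌊levelRate * k⌋₊ + 2 : ℕ)) := by
          gcongr
          exact four_pow_le_exp _
      _ ≤ 1 := by
          rw [← Real.exp_add, Real.exp_le_one_iff]
          push_cast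
          linarith
  nlinarith

/-- The probability that some level is served by too few trees is exponentially small. -/
lemma union_bound_le (k : ℕ) :
    ((⌊levelRate * k⌋₊ + 1 : ℕ) : ENNReal) * (2 ^ (2 * (⌊levelRate * k⌋₊ + 1)) *
      ENNReal.ofReal (1 - hitProb / 2) ^ (k * 2)) ≤
      ENNReal.ofReal (Real.exp (2 - hitProb / 2 * k)) := by
  have hp := hitProb_pos
  have hp1 := hitProb_le_one
  have hM : (⌊levelRate * k⌋₊ : ℝ) ≤ hitProb / 8 * k :=
    (Nat.floor_le (mul_nonneg levelRate_pos.le k.cast_nonneg)).trans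
      (mul_le_mul_of_nonneg_right (min_le_left _ _) k.cast_nonneg)
  set M := ⌊levelRate * k⌋₊
  have h1 : (1 - hitProb / 2) ^ (k * 2) ≤ Real.exp (-(hitProb * k)) := by
    have := Real.add_one_le_exp (-(hitProb / 2))
    calc _ ≤ Real.exp (-(hitProb / 2)) ^ (k * 2) :=
          pow_le_pow_left₀ (by linarith) (by linarith) _
      _ = _ := by rw [← Real.exp_nat_mul]; push_cast; ring_nf
  have h2 : ((M + 1 : ℕ) : ℝ) ≤ Real.exp M := by
    push_cast; exact Real.add_one_le_exp _
  have h3 : (2 : ℝ) ^ (2 * (M + 1)) ≤ Real.exp (2 * (M + 1 : ℕ)) := by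
    rw [pow_mul]
    exact (by norm_num : (2 : ℝ) ^ 2 = 4) ▸ four_pow_le_exp (M + 1)
  rw [← ENNReal.ofReal_pow (p := 1 - hitProb / 2) (by linarith), ← ENNReal.ofReal_natCast,
    show (2 : ENNReal) = ENNReal.ofReal 2 by simp, ← ENNReal.ofReal_pow (by norm_num),
    ← ENNReal.ofReal_mul (by positivity), ← ENNReal.ofReal_mul (by positivity)]
  refine ENNReal.ofReal_le_ofReal ?_
  calc _ ≤ Real.exp M * (Real.exp (2 * (M + 1 : ℕ)) * Real.exp (-(hitProb * k))) := by
        have h0 : 0 ≤ (1 - hitProb / 2) ^ (k * 2) := pow_nonneg (by linarith) _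
        exact mul_le_mul h2 (mul_le_mul h3 h1 h0 (by positivity)) (by positivity) (by positivity)
    _ ≤ _ := by
        rw [← Real.exp_add, ← Real.exp_add, Real.exp_le_exp]
        push_cast
        nlinarith

open Classical in
/-- Exponentially many steps are possible except with exponentially small probability. -/
lemma eventually_measure_compl_le {a b : ℝ} (h : a < b) : ∀ᶠ k : ℕ in atTop,
    ∀ [Fintype (depthTwoForest k (4 * k + 8)).edgeSet],
    randomInstance (depthTwoForest k (4 * k + 8)) a b
      {p | ∃ L, IsFlipExecution (depthTwoForest k (4 * k + 8)) p.1 3 p.2 L ∧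
        2 ^ ⌊levelRate * k⌋₊ ≤ L.length}ᶜ ≤
      ENNReal.ofReal (Real.exp (2 - hitProb / 2 * k)) := by
  have := Fact.mk h
  have := isProbabilityMeasure_flagLaw h
  have hD := sub_pos.2 h
  filter_upwards [eventually_hitProb_le a b (flagLaw_true_ge h), eventually_chainRate_pow_le hD]
    with k hk hk'
  intro _
  set M := ⌊levelRate * k⌋₊ with hM
  set μ := Measure.pi fun _ : Fin (2 * (4 * k + 8)) => midLaw a b (flagLaw a b)
  set P := Measure.pi fun _ : Fin k × Fin 2 => μ
  set few : ℕ → Set (Fin k × Fin 2 → Fin (2 * (4 * k + 8)) → MidData) := fun i =>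
    {ω | (Finset.univ.filter fun τ => ω τ ∈ {z | HitsLevel (b - a) M i z}).card < 2 * (M + 1)}
  have hfew : ∀ i ≤ M, P (few i) ≤
      2 ^ (2 * (M + 1)) * ENNReal.ofReal (1 - hitProb / 2) ^ (k * 2) := fun i hi => by
    have := measure_card_lt_le (T := Fin k × Fin 2) μ
      (H := {z | HitsLevel (b - a) M i z}) (measurableSet_hit _ measurableSet_Ioc)
      (hk _ (levelBase_pos hD M i) (levelBase_le hD hi)
        (hk'.trans (div_le_levelBase hD M i))) (2 * (M + 1))
    rwa [Fintype.card_prod, Fintype.card_fin, Fintype.card_fin] at this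
  have hwt : P {ω | ∀ τ, WeightsIn a b (ω τ)}ᶜ = 0 := by
    rw [← mem_ae_iff]
    exact ae_all_iff.2 fun _ => Measure.tendsto_eval_ae_ae.eventually
      (ae_weightsIn (γ := flagLaw a b) (Fin (2 * (4 * k + 8))))
  have hsub : {p | ∃ L, IsFlipExecution (depthTwoForest k (4 * k + 8)) p.1 3 p.2 L ∧
      2 ^ M ≤ L.length}ᶜ ⊆ forestData a b ⁻¹'
        ({ω | ∀ τ, WeightsIn a b (ω τ)}ᶜ ∪ ⋃ i ∈ Finset.range (M + 1), few i) := by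
    intro p hp
    by_contra hcon
    simp only [Set.mem_preimage, Set.mem_union, Set.mem_compl_iff, Set.mem_ofPred_eq,
      Set.mem_iUnion, not_or, not_not, not_exists, Finset.mem_range, few, not_lt] at hcon
    exact hp (exists_long_execution_of_hitsLevel hD p hcon.1 fun i hi =>
      hcon.2 i (Nat.lt_succ_of_le hi))
  have hmp := measurePreserving_forestData k (4 * k + 8) h
  calc _ ≤ _ := measure_mono hsub
    _ ≤ P ({ω | ∀ τ, WeightsIn a b (ω τ)}ᶜ ∪ ⋃ i ∈ Finset.range (M + 1), few i) :=
        (Measure.le_map_apply hmp.measurable.aemeasurable _).trans_eq (by rw [hmp.map_eq])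
    _ ≤ 0 + ∑ i ∈ Finset.range (M + 1), P (few i) :=
        (measure_union_le _ _).trans (add_le_add hwt.le (measure_biUnion_finset_le _ _))
    _ ≤ ∑ i ∈ Finset.range (M + 1),
          2 ^ (2 * (M + 1)) * ENNReal.ofReal (1 - hitProb / 2) ^ (k * 2) := by
        rw [zero_add]
        exact Finset.sum_le_sum fun i hi => hfew i (Nat.lt_succ_iff.1 (Finset.mem_range.1 hi))
    _ ≤ _ := by
        rw [Finset.sum_const, Finset.card_range, nsmul_eq_mul]
        exact union_bound_le k

lemma card_forestVertex (k m : ℕ) : Fintype.card (ForestVertex k m) = k * 2 * (1 + 6 * m) := by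
  have e : TreeVertex m ≃ Option (Fin (2 * m) × Option (Fin 2)) :=
    { toFun := fun
        | .center => none
        | .mid s => some (s, none)
        | .leaf s j => some (s, some j)
      invFun := fun
        | none => .center
        | some (s, none) => .mid s
        | some (s, some j) => .leaf s j
      left_inv := by rintro (_ | _ | _) <;> rfl
      right_inv := by rintro (_ | ⟨_, _ | _⟩) <;> rfl }
  rw [Fintype.card_prod, Fintype.card_congr e]
  simp only [Fintype.card_option, Fintype.card_prod, Fintype.card_fin]
  ring

lemma tendsto_nat_sqrt : Tendsto Nat.sqrt atTop atTop :=
  tendsto_atTop.2 fun b => (eventually_ge_atTop (b * b)).mono fun _ hn => Nat.le_sqrt.2 hn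

lemma two_rpow_le_two_pow_floor {n : ℕ} (hn : 2 + levelRate ≤ levelRate * Nat.sqrt n) :
    (2 : ℝ) ^ (levelRate / 2 * √(n : ℝ)) ≤ 2 ^ ⌊levelRate * Nat.sqrt n⌋₊ := by
  rw [← Real.rpow_natCast 2]
  refine Real.rpow_le_rpow_of_exponent_le (by norm_num) ?_
  have h1 : √(n : ℝ) ≤ Nat.sqrt n + 1 := Real.real_sqrt_le_nat_sqrt_succ
  have h2 := Nat.sub_one_lt_floor (levelRate * Nat.sqrt n)
  nlinarith [levelRate_pos]

theorem theorem1 :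
    ∃ (C c : ℝ) (m : ℕ → ℕ), 0 < C ∧ 0 < c ∧
      (∀ n : ℕ, (Fintype.card (ForestVertex (Nat.sqrt n) (m (Nat.sqrt n))) : ℝ) ≤ C * n) ∧
      ∀ a b : ℝ, a < b →
        Tendsto
          (fun n : ℕ =>
            randomInstance (depthTwoForest (Nat.sqrt n) (m (Nat.sqrt n))) a b
              {p | ∃ L : List (Finset (ForestVertex (Nat.sqrt n) (m (Nat.sqrt n)))),
                IsFlipExecution (depthTwoForest (Nat.sqrt n) (m (Nat.sqrt n))) p.1 3 p.2 L ∧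
                  (2 : ℝ) ^ (c * √(n : ℝ)) ≤ (L.length : ℝ)})
          atTop (𝓝 1) := by
  refine ⟨146, levelRate / 2, fun k => 4 * k + 8, by norm_num, by linarith [levelRate_pos], ?_, ?_⟩
  · -- `2 k (1 + 6 (4 k + 8)) = 48 k ^ 2 + 98 k ≤ 146 n`
    intro n
    have h : Fintype.card (ForestVertex (Nat.sqrt n) (4 * Nat.sqrt n + 8)) ≤ 146 * n := by
      rw [card_forestVertex]
      have h1 := Nat.sqrt_le n
      have h2 := Nat.le_mul_self (Nat.sqrt n)
      nlinarith
    exact_mod_cast h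
  · intro a b hab
    have hk : Tendsto (fun n : ℕ => (Nat.sqrt n : ℝ)) atTop atTop :=
      tendsto_natCast_atTop_atTop.comp tendsto_nat_sqrt
    have hprob : ∀ n : ℕ, IsProbabilityMeasure
        (randomInstance (depthTwoForest (Nat.sqrt n) (4 * Nat.sqrt n + 8)) a b) := fun n => by
      have := isProbabilityMeasure_unif hab
      unfold randomInstance
      infer_instance
    have hlim : Tendsto (fun n : ℕ => 1 -
        ENNReal.ofReal (Real.exp (2 - hitProb / 2 * (Nat.sqrt n : ℝ)))) atTop (𝓝 1) := by
      have h1 : Tendsto (fun n : ℕ => Real.exp (2 - hitProb / 2 * (Nat.sqrt n : ℝ))) atTop (𝓝 0) :=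
        Real.tendsto_exp_atBot.comp (tendsto_atBot_add_const_left _ 2
          (tendsto_neg_atTop_atBot.comp (hk.const_mul_atTop (half_pos hitProb_pos))))
      simpa using ENNReal.Tendsto.sub (tendsto_const_nhds (x := (1 : ENNReal)))
        (ENNReal.tendsto_ofReal h1) (Or.inl ENNReal.one_ne_top)
    refine tendsto_of_tendsto_of_tendsto_of_le_of_le' hlim tendsto_const_nhds ?_
      (Eventually.of_forall fun _ => prob_le_one)
    filter_upwards [tendsto_nat_sqrt.eventually (eventually_measure_compl_le hab),
      (hk.const_mul_atTop levelRate_pos).eventually_ge_atTop (2 + levelRate)] with n hn hn'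
    rw [tsub_le_iff_right]
    refine le_trans ?_ (add_le_add le_rfl hn)
    rw [← (hprob n).measure_univ]
    refine (measure_mono ?_).trans (measure_union_le _ _)
    refine fun p _ => or_iff_not_imp_right.2 fun hp => ?_
    obtain ⟨L, hL, hlen⟩ := not_not.1 hp
    exact ⟨L, hL, (two_rpow_le_two_pow_floor hn').trans (by exact_mod_cast hlen)⟩
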